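/- Let $p$ be a prime, put $x=1/p$ and $f_n(x)=(1-x)(1-x^2)\cdots(1-x^n)$. For $r\ge 1$ and $1\le i\le r+1$ let $$T_{r,i}(k_1,\dots,k_r)=\frac{x^{k_1^2+\cdots+k_r^2+k_i+\cdots+k_r}}{f_{k_1-k_2}(x)\cdots f_{k_{r-1}-k_r}(x)\,f_{k_r}(x)}\qquad(k_1\ge\cdots\ge k_r\ge 0)$$ be the general term of the left side, and $$P_{r,i}=\prod_{j>0,\ j\not\equiv 0,\pm i\ (\mathrm{mod}\ 2r+3)}\frac1{1-x^j}$$ the right side, of the Andrews–Gordon identity at $x=1/p$ (for $i=r+1$ the linear part $k_i+\cdots+k_r$ of the exponent is empty). Let $\mathcal A_p$ be the set of isomorphism classes of finite abelian $p$-groups, and let $\mathrm{Hol}(G)=G\rtimes \mathrm{Aut}(G)$ be the holomorph. For $k=(k_1\ge\cdots\ge k_r\ge0)$ let $G_k$ be the direct product of the cyclic groups of orders $p^{\lambda_1},p^{\lambda_2},\dots$, where $(\lambda_1,\lambda_2,\dots)$ is the partition dual to $k$. All sums and products below converge. (a) For every $r\ge1$, $k\mapsto G_k$ is a bijection from the sequences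 $k_1\ge\cdots\ge k_r\ge0$ onto the groups $G\in\mathcal A_p$ with $\exp(G)\le p^r$. One has $T_{r,r+1}(k)=1/|\mathrm{Aut}(G_k)|$ and $T_{r,1}(k)=1/|\mathrm{Hol}(G_k)|$ for all such $k$, and $$\sum_{k}T_{r,r+1}(k)=\sum_{G\in\mathcal A_p,\ \exp(G)\le p^r}\frac1{|\mathrm{Aut}(G)|}=\prod_{j>0,\ j\not\equiv0,\pm(r+1)\ (\mathrm{mod}\ 2r+3)}\frac1{1-p^{-j}},$$ $$\sum_{k}T_{r,1}(k)=\sum_{G\in\mathcal A_p,\ \exp(G)\le p^r}\frac1{|\mathrm{Hol}(G)|}=\prod_{j>0,\ j\not\equiv0,\pm1\ (\mathrm{mod}\ 2r+3)}\frac1{1-p^{-j}}.$$ (b) As $r\to\infty$, $\sum_kT_{r,r+1}(k)\to\sum_{G\in\mathcal A_p}1/|\mathrm{Aut}(G)|$ and $P_{r,r+1}\to\sum_{G\in\mathcal A_p}1/|G|=\prod_{j\ge1}(1-p^{-j})^{-1}=\sum_{n\ge0}\pi(n)p^{-n}$, where $\pi(n)$ is the number of partitions of $n$. The limiting form of the identity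 is Hall's formula $$\sum_{G\in\mathcal A_p}\frac1{|G|}=\sum_{G\in\mathcal A_p}\frac1{|\mathrm{Aut}(G)|}.$$ (c) As $r\to\infty$, $\sum_kT_{r,1}(k)\to\sum_{G\in\mathcal A_p}1/|\mathrm{Hol}(G)|$ and $P_{r,1}\to\prod_{j\ge2}(1-p^{-j})^{-1}$, so that $$\sum_{G\in\mathcal A_p}\frac1{|\mathrm{Hol}(G)|}=\prod_{j\ge2}\frac1{1-p^{-j}}.$$ -/

import Mathlib

open Filter Topology

/-- A finite abelian `p`-group, written multiplicatively. -/
structure FinAbPGroup (p : ℕ) where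
  carrier : Type
  [commGroup : CommGroup carrier]
  [finite : Finite carrier]
  isPGroup : IsPGroup p carrier

attribute [instance] FinAbPGroup.commGroup FinAbPGroup.finite

/-- Two finite abelian `p`-groups are equivalent when they are isomorphic. -/
instance FinAbPGroup.isoSetoid (p : ℕ) : Setoid (FinAbPGroup p) where
  r G H := Nonempty (G.carrier ≃* H.carrier)
  iseqv :=
    { refl := fun G => ⟨MulEquiv.refl G.carrier⟩
      symm := fun ⟨e⟩ => ⟨e.symm⟩
      trans := fun ⟨e⟩ ⟨f⟩ => ⟨e.trans f⟩ }

/-- The isomorphism classes of finite abelian `p`-groups. -/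
def AbPClass (p : ℕ) : Type 1 := Quotient (FinAbPGroup.isoSetoid p)

/-- The holomorph of `G`: the semidirect product of `G` with `Aut(G)` acting naturally. -/
abbrev Holomorph (G : Type) [Group G] : Type :=
  SemidirectProduct G (MulAut G) (MonoidHom.id (MulAut G))

theorem card_holomorph (G : Type) [Group G] :
    Nat.card (Holomorph G) = Nat.card G * Nat.card (MulAut G) :=
  SemidirectProduct.card

theorem card_mulAut_congr {G H : Type} [Group G] [Group H] (e : G ≃* H) :
    Nat.card (MulAut G) = Nat.card (MulAut H) :=
  Nat.card_congr (MulAut.congr e).toEquiv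

namespace AbPClass

variable {p : ℕ}

/-- The order `|G|`. -/
noncomputable def card (c : AbPClass p) : ℕ :=
  Quotient.lift (s := FinAbPGroup.isoSetoid p) (fun G : FinAbPGroup p => Nat.card G.carrier)
    (fun _ _ h => h.elim fun e => Nat.card_congr e.toEquiv) c

/-- The exponent of `G`. -/
noncomputable def exponent (c : AbPClass p) : ℕ :=
  Quotient.lift (s := FinAbPGroup.isoSetoid p) (fun G : FinAbPGroup p => Monoid.exponent G.carrier)
    (fun _ _ h => h.elim fun e => Monoid.exponent_eq_of_mulEquiv e) c

/-- The order `|Aut(G)|`. -/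
noncomputable def cardAut (c : AbPClass p) : ℕ :=
  Quotient.lift (s := FinAbPGroup.isoSetoid p) (fun G : FinAbPGroup p => Nat.card (MulAut G.carrier))
    (fun _ _ h => h.elim fun e => card_mulAut_congr e) c

/-- The order `|Hol(G)|`. -/
noncomputable def cardHol (c : AbPClass p) : ℕ :=
  Quotient.lift (s := FinAbPGroup.isoSetoid p) (fun G : FinAbPGroup p => Nat.card (Holomorph G.carrier))
    (fun G H h => by
      obtain ⟨e⟩ := h
      simp only [card_holomorph, card_mulAut_congr e, Nat.card_congr e.toEquiv]) c

end AbPClass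

/-- The part with index `m` (counted from `0`) of the partition dual to `k`: the number of
parts of `k` that are greater than `m`. -/
def dualPart {r : ℕ} (k : Fin r → ℕ) (m : ℕ) : ℕ :=
  (Finset.univ.filter (fun j => m < k j)).card

/-- The direct product of cyclic groups whose orders are `p ^ l`, for `l` running through the
parts of the partition dual to `k`. -/
def dualGroup (p : ℕ) [Fact p.Prime] {r : ℕ} (k : Fin r → ℕ) : FinAbPGroup p where
  carrier := (m : Fin (Finset.univ.sup k)) → Multiplicative (ZMod (p ^ dualPart k m))
  finite := by
    have : ∀ m : Fin (Finset.univ.sup k), NeZero (p ^ dualPart k m) :=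
      fun m => ⟨pow_ne_zero _ (Fact.out : p.Prime).ne_zero⟩
    have : ∀ m : Fin (Finset.univ.sup k), Finite (Multiplicative (ZMod (p ^ dualPart k m))) :=
      fun m => inferInstanceAs (Finite (ZMod (p ^ dualPart k m)))
    infer_instance
  isPGroup := by
    refine IsPGroup.of_card (n := ∑ m : Fin (Finset.univ.sup k), dualPart k m) ?_
    rw [Nat.card_pi, ← Finset.prod_pow_eq_pow_sum]
    exact Finset.prod_congr rfl fun m _ => Nat.card_zmod _

/-- The isomorphism class of `dualGroup p k`. -/
def dualClass (p : ℕ) [Fact p.Prime] {r : ℕ} (k : Fin r → ℕ) : AbPClass p :=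
  Quotient.mk (FinAbPGroup.isoSetoid p) (dualGroup p k)

/-- `f_n(x) = (1 - x)(1 - x^2) ⋯ (1 - x^n)`. -/
def eulerPoly (n : ℕ) (x : ℝ) : ℝ := ∏ m ∈ Finset.Icc 1 n, (1 - x ^ m)

/-- The successor part `k_{j+1}`, with the convention `k_{r+1} = 0`. -/
def nextPart {r : ℕ} (k : Fin r → ℕ) (j : Fin r) : ℕ :=
  if h : (j : ℕ) + 1 < r then k ⟨(j : ℕ) + 1, h⟩ else 0

/-- The general term
`x^(k_1^2 + ⋯ + k_r^2 + k_i + ⋯ + k_r) / (f_{k_1-k_2}(x) ⋯ f_{k_{r-1}-k_r}(x) f_{k_r}(x))`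
of the left side of the Andrews-Gordon identity; `k_j` is `k ⟨j - 1, _⟩`. -/
noncomputable def agTerm (r i : ℕ) (x : ℝ) (k : Fin r → ℕ) : ℝ :=
  x ^ (∑ j, k j ^ 2 + ∑ j ∈ Finset.univ.filter (fun j : Fin r => i ≤ (j : ℕ) + 1), k j) /
    ∏ j, eulerPoly (k j - nextPart k j) x

/-- The index set `k_1 ≥ k_2 ≥ ⋯ ≥ k_r ≥ 0`. -/
abbrev AGIndex (r : ℕ) : Type := {k : Fin r → ℕ // Antitone k}

/-- The indices `j > 0` with `j ≢ 0, ±i (mod 2r+3)`. -/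
abbrev AGProdIndex (r i : ℕ) : Type :=
  {j : ℕ // 0 < j ∧ ¬ (j : ℤ) ≡ 0 [ZMOD (2 * r + 3)] ∧ ¬ (j : ℤ) ≡ i [ZMOD (2 * r + 3)] ∧
    ¬ (j : ℤ) ≡ -i [ZMOD (2 * r + 3)]}

/-- The factor `1 / (1 - x^j)`. -/
noncomputable def geomFactor (x : ℝ) (j : ℕ) : ℝ := 1 / (1 - x ^ j)

/-- The right side of the Andrews-Gordon identity. -/
noncomputable def agProd (r i : ℕ) (x : ℝ) : ℝ := ∏' j : AGProdIndex r i, geomFactor x j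

/-! ### Bailey pairs with a finite Durfee identity -/

section EulerPoly

variable {x : ℝ}

/-! Put `x = 1/p`. The analytic half is a Bailey chain, run for `e = 0` (the case `i = r + 1`) and
`e = 1` (the case `i = 1`) at once. A sequence `α` has the transform `β_n = ∑ α_m / (f_{n-m}
f_{n+m+e})`. Multiplying `α_m` by `x^(m^2 + e m)` replaces `β_n` by `∑_s x^(s^2 + e s) β_s /
f_{n-s}` (`baileySum_step`). The unit pair has `β_n = 0` for `n > 0`, so iteration turns `β_n` into
the multiple sum over `k_1 ≥ ... ≥ k_r` with `k_1 ≤ n` (`hasSum_boundedTerm`).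

Letting `n → ∞` equates the Andrews-Gordon sum with `(∑ α_m) / f_∞`. The series `∑ α_m` folds a
theta series over the integers, which the Jacobi triple product (`hasSum_tripleProduct`) factors
into the residue classes `0, ±i` modulo `2r + 3`. Division by `f_∞` leaves exactly the other classes
(`hasSum_agTerm`).

The algebraic half counts automorphisms. An endomorphism of a product of cyclic `p`-groups is a
choice of images of the generators, and it is injective exactly when the multiples of these images
in the `p`-torsion are linearly independent over `ZMod p`. Choosing the images one by one gives
`|Aut|` as a product (`card_addAut_pi_zmod`). Since `G_k` has `p^(k_1 + ... + k_m)` elements killed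
by `p^m`, this product is the reciprocal of `T_{r,r+1}(k)` (`one_div_cardAut_dualClass`). The linear
part of the exponent for `i = 1` accounts for `|G_k|`, hence for the holomorph. The structure
theorem gives the bijection with groups of exponent at most `p^r` (`bijOn_dualClass`).

As `r → ∞` only the term `m = 0` of the theta series survives (`tendsto_agProd`), and the groups of
bounded exponent exhaust all groups (`hasSum_of_exhaustion`). The sum of `1/|G|` comes separately
from the generating function of partitions, because `|G_k| = p^(k_1 + ... + k_r)`. -/

@[simp]
theorem eulerPoly_zero (x : ℝ) : eulerPoly 0 x = 1 := by simp [eulerPoly]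

theorem eulerPoly_succ (n : ℕ) (x : ℝ) :
    eulerPoly (n + 1) x = eulerPoly n x * (1 - x ^ (n + 1)) := by
  rw [eulerPoly, Finset.prod_Icc_succ_top (by omega)]; rfl

theorem one_sub_pow_succ_pos (h0 : 0 ≤ x) (h1 : x < 1) (n : ℕ) : 0 < 1 - x ^ (n + 1) :=
  sub_pos.2 (pow_lt_one₀ h0 h1 n.succ_ne_zero)

theorem eulerPoly_pos (h0 : 0 ≤ x) (h1 : x < 1) (n : ℕ) : 0 < eulerPoly n x := by
  induction n with
  | zero => simp
  | succ n ih => rw [eulerPoly_succ]; exact mul_pos ih (one_sub_pow_succ_pos h0 h1 n)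

theorem eulerPoly_eq_prod_range (n : ℕ) (x : ℝ) :
    eulerPoly n x = ∏ m ∈ Finset.range n, (1 - x ^ (m + 1)) := by
  induction n with
  | zero => simp
  | succ n ih => rw [eulerPoly_succ, Finset.prod_range_succ, ih]

theorem eulerPoly_antitone (h0 : 0 ≤ x) (h1 : x < 1) : Antitone fun n => eulerPoly n x := by
  refine antitone_nat_of_succ_le fun n => ?_
  rw [eulerPoly_succ]
  exact mul_le_of_le_one_right (eulerPoly_pos h0 h1 n).le (by linarith [pow_nonneg h0 (n + 1)])

open Finset.HasAntidiagonal in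
/-- The finite form of the Durfee rectangle identity. -/
theorem sum_antidiagonal_durfee (h0 : 0 ≤ x) (h1 : x < 1) (A D : ℕ) :
    ∑ u ∈ antidiagonal A, x ^ (u.1 * (u.1 + D)) /
      (eulerPoly u.1 x * eulerPoly u.2 x * eulerPoly (u.1 + D) x) =
      1 / (eulerPoly A x * eulerPoly (A + D) x) := by
  induction A generalizing D with
  | zero => simp
  | succ A ih =>
    have hne := fun n => (eulerPoly_pos h0 h1 n).ne'
    have hs := fun n => (one_sub_pow_succ_pos h0 h1 n).ne'
    have key : (1 - x ^ (A + 1)) * ∑ u ∈ antidiagonal (A + 1), x ^ (u.1 * (u.1 + D)) /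
        (eulerPoly u.1 x * eulerPoly u.2 x * eulerPoly (u.1 + D) x) =
        ∑ u ∈ antidiagonal A, x ^ (u.1 * (u.1 + (D + 1))) /
        (eulerPoly u.1 x * eulerPoly u.2 x * eulerPoly (u.1 + (D + 1)) x) := by
      -- With `u.1 + u.2 = A + 1`, write `1 - x^(A+1) = (1 - x^u.1) + x^u.1 (1 - x^u.2)`. Each piece
      -- kills one end of the antidiagonal, and the shifted remainders add up termwise to the sum
      -- for `A` and `D + 1`.
      have split : (1 - x ^ (A + 1)) * ∑ u ∈ antidiagonal (A + 1), x ^ (u.1 * (u.1 + D)) /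
          (eulerPoly u.1 x * eulerPoly u.2 x * eulerPoly (u.1 + D) x) =
          ∑ u ∈ antidiagonal (A + 1), (1 - x ^ u.1) * (x ^ (u.1 * (u.1 + D)) /
            (eulerPoly u.1 x * eulerPoly u.2 x * eulerPoly (u.1 + D) x)) +
          ∑ u ∈ antidiagonal (A + 1), (1 - x ^ u.2) * (x ^ u.1 * (x ^ (u.1 * (u.1 + D)) /
            (eulerPoly u.1 x * eulerPoly u.2 x * eulerPoly (u.1 + D) x))) := by
        rw [Finset.mul_sum, ← Finset.sum_add_distrib]
        refine Finset.sum_congr rfl fun u hu => ?_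
        rw [← mem_antidiagonal.1 hu, pow_add]
        ring
      rw [split, Finset.Nat.sum_antidiagonal_succ, Finset.Nat.sum_antidiagonal_succ']
      simp only [pow_zero, sub_self, zero_mul, zero_add]
      rw [← Finset.sum_add_distrib]
      refine Finset.sum_congr rfl fun u _ => ?_
      have e1 : u.1 + 1 + D = u.1 + D + 1 := by ring
      have e2 : u.1 + (D + 1) = u.1 + D + 1 := by ring
      rw [e1, e2]
      simp only [eulerPoly_succ]
      have := hne u.1; have := hne u.2; have := hne (u.1 + D)
      have := hs u.1; have := hs u.2; have := hs (u.1 + D)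
      field_simp
      ring
    rw [ih] at key
    rw [eulerPoly_succ, show A + 1 + D = A + (D + 1) by ring]
    have := hs A; have := hne A; have := hne (A + (D + 1))
    field_simp at key ⊢
    linarith

/-- The second member of the Bailey pair with first member `α`, relative to `x ^ e`. -/
noncomputable def baileySum (x : ℝ) (e : ℕ) (α : ℕ → ℝ) (n : ℕ) : ℝ :=
  ∑ m ∈ Finset.range (n + 1), α m / (eulerPoly (n - m) x * eulerPoly (n + m + e) x)

/-- A limiting case of Bailey's lemma. -/
theorem baileySum_step (h0 : 0 ≤ x) (h1 : x < 1) (e : ℕ) (α : ℕ → ℝ) (n : ℕ) :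
    baileySum x e (fun m => x ^ (m ^ 2 + e * m) * α m) n =
      ∑ s ∈ Finset.range (n + 1), x ^ (s ^ 2 + e * s) / eulerPoly (n - s) x *
        baileySum x e α s := by
  have inner : ∀ m ∈ Finset.range (n + 1),
      x ^ (m ^ 2 + e * m) * α m / (eulerPoly (n - m) x * eulerPoly (n + m + e) x) =
      ∑ s ∈ Finset.Ico m (n + 1), x ^ (s ^ 2 + e * s) / eulerPoly (n - s) x *
        (α m / (eulerPoly (s - m) x * eulerPoly (s + m + e) x)) := by
    intro m hm
    obtain ⟨A, rfl⟩ := Nat.exists_eq_add_of_le (Nat.lt_succ_iff.1 (Finset.mem_range.1 hm))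
    -- With `s = m + u` the exponent splits as `(m^2 + e m) + u (u + 2 m + e)`, which makes the sum
    -- over `s` a Durfee sum with `D = 2 m + e`.
    have := sum_antidiagonal_durfee h0 h1 A (2 * m + e)
    rw [Finset.Nat.sum_antidiagonal_eq_sum_range_succ_mk] at this
    rw [Finset.sum_Ico_eq_sum_range, show m + A + 1 - m = A + 1 by omega,
      show m + A - m = A by omega, show m + A + m + e = A + (2 * m + e) by ring,
      ← mul_one_div, ← this, Finset.mul_sum]
    refine Finset.sum_congr rfl fun u hu => ?_
    rw [show m + A - (m + u) = A - u by omega, show m + u - m = u by omega,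
      show m + u + m + e = u + (2 * m + e) by ring,
      show (m + u) ^ 2 + e * (m + u) = (m ^ 2 + e * m) + u * (u + (2 * m + e)) by ring, pow_add]
    simp only [div_eq_mul_inv, mul_inv]
    ring
  simp only [baileySum, Finset.mul_sum]
  rw [Finset.sum_congr rfl inner]
  refine Finset.sum_comm' fun m s => ?_
  simp only [Finset.mem_range, Finset.mem_Ico]
  omega

/-- The unit Bailey pair relative to `1`. -/
noncomputable def unitBaileyZero (x : ℝ) (m : ℕ) : ℝ :=
  if m = 0 then 1 else (-1) ^ m * x ^ (m * (m - 1) / 2) * (1 + x ^ m)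

/-- The unit Bailey pair relative to `x`. -/
noncomputable def unitBaileyOne (x : ℝ) (m : ℕ) : ℝ :=
  (-1) ^ m * x ^ (m * (m - 1) / 2) * (1 - x ^ (2 * m + 1))

theorem triangle_succ (m : ℕ) : (m + 1) * (m + 1 - 1) / 2 = m * (m - 1) / 2 + m := by
  rw [← Finset.sum_range_id_mul_two, ← Finset.sum_range_id_mul_two m, Finset.sum_range_succ]
  omega

/-- The sum telescopes: its partial sum up to `M` has a closed form with the factor `1 - x^(n-M)`,
which vanishes when all terms are included and `n > 0`. The pair relative to `x` behaves in the same
way. -/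
theorem baileySum_unitBaileyZero (h0 : 0 ≤ x) (h1 : x < 1) (n : ℕ) :
    baileySum x 0 (unitBaileyZero x) n = if n = 0 then 1 else 0 := by
  obtain rfl | ⟨n, rfl⟩ : n = 0 ∨ ∃ k, n = k + 1 := by
    cases n <;> simp
  · simp [baileySum, unitBaileyZero]
  have hne := fun n => (eulerPoly_pos h0 h1 n).ne'
  have hs := fun n => (one_sub_pow_succ_pos h0 h1 n).ne'
  have partialSum : ∀ M ≤ n + 1, ∑ m ∈ Finset.range (M + 1), unitBaileyZero x m /
      (eulerPoly (n + 1 - m) x * eulerPoly (n + 1 + m + 0) x) =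
      (-1) ^ M * x ^ ((M + 1) * (M + 1 - 1) / 2) * (1 - x ^ (n + 1 - M)) /
        (eulerPoly (n + 1 - M) x * eulerPoly (n + 1 + M) x * (1 - x ^ (n + 1))) := by
    intro M hM
    induction M with
    | zero =>
      have := hs n; have := hne (n + 1)
      simp [unitBaileyZero]
      field_simp
    | succ M ih =>
      obtain ⟨A, rfl⟩ := Nat.exists_eq_add_of_le (show M ≤ n by omega)
      rw [Finset.sum_range_succ, ih (by omega), triangle_succ (M + 1)]
      rw [show M + A + 1 - M = A + 1 by omega, show M + A + 1 - (M + 1) = A by omega,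
        unitBaileyZero, if_neg (by omega), add_zero, ← add_assoc (M + A + 1), eulerPoly_succ,
        eulerPoly_succ (M + A + 1 + M)]
      have := hne A; have := hne (M + A + 1 + M); have := hs A; have := hs (M + A)
      have := hs (M + A + 1 + M)
      field_simp
      ring
  rw [baileySum, partialSum (n + 1) le_rfl]
  simp

theorem baileySum_unitBaileyOne (h0 : 0 ≤ x) (h1 : x < 1) (n : ℕ) :
    baileySum x 1 (unitBaileyOne x) n = if n = 0 then 1 else 0 := by
  have hne := fun n => (eulerPoly_pos h0 h1 n).ne'
  have hs := fun n => (one_sub_pow_succ_pos h0 h1 n).ne'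
  obtain rfl | ⟨n, rfl⟩ : n = 0 ∨ ∃ k, n = k + 1 := by
    cases n <;> simp
  · have := hs 0
    simp at this
    simp [baileySum, unitBaileyOne, eulerPoly, div_self this]
  have partialSum : ∀ M ≤ n + 1, ∑ m ∈ Finset.range (M + 1), unitBaileyOne x m /
      (eulerPoly (n + 1 - m) x * eulerPoly (n + 1 + m + 1) x) =
      (-1) ^ M * x ^ ((M + 1) * (M + 1 - 1) / 2) * (1 - x ^ (n + 1 - M)) * (1 - x ^ (M + 1)) /
        (eulerPoly (n + 1 - M) x * eulerPoly (n + 1 + M + 1) x * (1 - x ^ (n + 1))) := by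
    intro M hM
    induction M with
    | zero =>
      have := hs n; have := hne (n + 1); have := hne (n + 1 + 1)
      simp [unitBaileyOne]
      field_simp
    | succ M ih =>
      obtain ⟨A, rfl⟩ := Nat.exists_eq_add_of_le (show M ≤ n by omega)
      rw [Finset.sum_range_succ, ih (by omega), triangle_succ (M + 1)]
      rw [show M + A + 1 - M = A + 1 by omega, show M + A + 1 - (M + 1) = A by omega,
        unitBaileyOne, ← add_assoc (M + A + 1), eulerPoly_succ,
        eulerPoly_succ (M + A + 1 + M + 1)]
      have := hne A; have := hne (M + A + 1 + M + 1); have := hs A; have := hs (M + A)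
      have := hs (M + A + 1 + M + 1)
      field_simp
      ring
  rw [baileySum, partialSum (n + 1) le_rfl]
  simp

end EulerPoly

/-! ### Infinite products and the limit of a Bailey pair -/

section Products

variable {x : ℝ}

theorem multipliable_one_sub {ι : Type*} {f : ι → ℝ} (hf : Summable f) :
    Multipliable fun i => 1 - f i := by
  simpa [sub_eq_add_neg] using Real.multipliable_one_add_of_summable hf.neg

theorem tprod_one_sub_pos {ι : Type*} {f : ι → ℝ} (hf : Summable f) (h1 : ∀ i, f i < 1) :
    0 < ∏' i, (1 - f i) := by
  refine lt_of_le_of_ne ?_ (Ne.symm ?_)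
  · exact ge_of_tendsto' (multipliable_one_sub hf).hasProd fun s =>
      Finset.prod_nonneg fun i _ => sub_nonneg.2 (h1 i).le
  · simpa [sub_eq_add_neg] using tprod_one_add_ne_zero_of_summable (f := fun i => -f i)
      (fun i => by linarith [h1 i]) (by simpa using hf.norm)

theorem hasProd_one_div_one_sub {ι : Type*} {f : ι → ℝ} (hf : Summable f) (h1 : ∀ i, f i < 1) :
    HasProd (fun i => 1 / (1 - f i)) (1 / ∏' i, (1 - f i)) := by
  simpa using (multipliable_one_sub hf).hasProd.inv₀ (tprod_one_sub_pos hf h1).ne'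

theorem summable_mul_pow (h0 : 0 ≤ x) (h1 : x < 1) (z : ℝ) : Summable fun n : ℕ => z * x ^ n :=
  (summable_geometric_of_lt_one h0 h1).mul_left z

theorem summable_pow_succ (h0 : 0 ≤ x) (h1 : x < 1) : Summable fun n : ℕ => x ^ (n + 1) :=
  (summable_nat_add_iff 1).2 (summable_geometric_of_lt_one h0 h1)

/-- Euler's product `(1 - x)(1 - x^2)(1 - x^3) ⋯`. -/
noncomputable def eulerInf (x : ℝ) : ℝ := ∏' n : ℕ, (1 - x ^ (n + 1))

theorem eulerInf_pos (h0 : 0 ≤ x) (h1 : x < 1) : 0 < eulerInf x :=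
  tprod_one_sub_pos (summable_pow_succ h0 h1) fun n => pow_lt_one₀ h0 h1 n.succ_ne_zero

theorem tendsto_eulerPoly (h0 : 0 ≤ x) (h1 : x < 1) :
    Tendsto (fun n => eulerPoly n x) atTop (𝓝 (eulerInf x)) := by
  simp only [eulerPoly_eq_prod_range]
  exact (multipliable_one_sub (summable_pow_succ h0 h1)).hasProd.tendsto_prod_nat

theorem eulerInf_le_eulerPoly (h0 : 0 ≤ x) (h1 : x < 1) (n : ℕ) : eulerInf x ≤ eulerPoly n x :=
  (eulerPoly_antitone h0 h1).le_of_tendsto (tendsto_eulerPoly h0 h1) n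

theorem one_div_eulerPoly_le (h0 : 0 ≤ x) (h1 : x < 1) (n : ℕ) :
    1 / eulerPoly n x ≤ 1 / eulerInf x :=
  one_div_le_one_div_of_le (eulerInf_pos h0 h1) (eulerInf_le_eulerPoly h0 h1 n)

/-- Dominated convergence: both Euler factors in each denominator decrease to `eulerInf x`, so the
terms are at most `|α m| / eulerInf x ^ 2`. -/
theorem tendsto_baileySum (h0 : 0 ≤ x) (h1 : x < 1) (e : ℕ) {α : ℕ → ℝ} (hα : Summable α) :
    Tendsto (baileySum x e α) atTop (𝓝 ((∑' m, α m) / (eulerInf x * eulerInf x))) := by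
  have hsum : ∀ n, baileySum x e α n = ∑' m, (if m < n + 1 then
      α m / (eulerPoly (n - m) x * eulerPoly (n + m + e) x) else 0) := by
    intro n
    rw [baileySum, tsum_eq_sum (s := Finset.range (n + 1))
      (fun m hm => if_neg (by simpa using hm))]
    exact Finset.sum_congr rfl fun m hm => (if_pos (Finset.mem_range.1 hm)).symm
  rw [← tsum_div_const, funext hsum]
  have hE := eulerInf_pos h0 h1
  refine tendsto_tsum_of_dominated_convergence
    (bound := fun m => |α m| / (eulerInf x * eulerInf x)) (hα.abs.div_const _) ?_ ?_
  · intro m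
    have hlim := ((tendsto_eulerPoly h0 h1).comp (tendsto_sub_atTop_nat m)).mul
      ((tendsto_eulerPoly h0 h1).comp (tendsto_add_atTop_nat (m + e)))
    refine ((tendsto_const_nhds (x := α m)).div hlim (mul_pos hE hE).ne').congr' ?_
    filter_upwards [eventually_ge_atTop m] with n hn
    simp [Nat.lt_succ_of_le hn, add_assoc]
  · refine Eventually.of_forall fun n m => ?_
    split_ifs
    · rw [norm_div, Real.norm_eq_abs, Real.norm_eq_abs, abs_of_pos (a := eulerPoly _ x * _)
        (mul_pos (eulerPoly_pos h0 h1 _) (eulerPoly_pos h0 h1 _))]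
      have := eulerInf_le_eulerPoly h0 h1 (n - m)
      have := eulerInf_le_eulerPoly h0 h1 (n + m + e)
      have := (eulerPoly_pos h0 h1 (n - m)).le
      gcongr
    · simp only [norm_zero]; positivity

end Products

/-! ### The Jacobi triple product -/

section TripleProduct

variable {x : ℝ}

/-- The reciprocal of `eulerPoly`, extended by zero to the negative integers. -/
noncomputable def invEuler (x : ℝ) (n : ℤ) : ℝ := if n < 0 then 0 else 1 / eulerPoly n.toNat x

theorem invEuler_natCast (x : ℝ) (n : ℕ) : invEuler x n = 1 / eulerPoly n x := by
  simp [invEuler]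

theorem invEuler_of_neg (x : ℝ) {n : ℤ} (h : n < 0) : invEuler x n = 0 := if_pos h

/-- Extension by zero makes the recurrence hold at every integer (at `0` the factor `1 - x^0`
vanishes), so the finite triple product can be summed over all integers without boundary terms. -/
theorem invEuler_sub_one (h0 : 0 ≤ x) (h1 : x < 1) (n : ℤ) :
    invEuler x (n - 1) = (1 - x ^ n) * invEuler x n := by
  rcases lt_trichotomy n 0 with h | rfl | h
  · rw [invEuler_of_neg x h, invEuler_of_neg x (by omega), mul_zero]
  · simp [invEuler]
  · obtain ⟨m, rfl⟩ : ∃ m : ℕ, n = (m + 1 : ℕ) := ⟨(n - 1).toNat, by omega⟩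
    rw [show ((m + 1 : ℕ) : ℤ) - 1 = m by push_cast; ring, invEuler_natCast, invEuler_natCast,
      eulerPoly_succ, zpow_natCast]
    have := (eulerPoly_pos h0 h1 m).ne'
    have := (one_sub_pow_succ_pos h0 h1 m).ne'
    field_simp

theorem invEuler_nonneg (h0 : 0 ≤ x) (h1 : x < 1) (n : ℤ) : 0 ≤ invEuler x n := by
  rw [invEuler]
  split_ifs
  · rfl
  · exact one_div_nonneg.2 (eulerPoly_pos h0 h1 _).le

theorem invEuler_le (h0 : 0 ≤ x) (h1 : x < 1) (n : ℤ) : invEuler x n ≤ 1 / eulerInf x := by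
  rw [invEuler]
  split_ifs
  · exact one_div_nonneg.2 (eulerInf_pos h0 h1).le
  · exact one_div_eulerPoly_le h0 h1 _

theorem tendsto_invEuler (h0 : 0 ≤ x) (h1 : x < 1) :
    Tendsto (invEuler x) atTop (𝓝 (1 / eulerInf x)) := by
  have h : Tendsto (fun n : ℤ => 1 / eulerPoly n.toNat x) atTop (𝓝 (1 / eulerInf x)) :=
    tendsto_const_nhds.div ((tendsto_eulerPoly h0 h1).comp
      (tendsto_atTop_atTop.2 fun b => ⟨b, fun n hn => by omega⟩)) (eulerInf_pos h0 h1).ne'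
  refine h.congr' ?_
  filter_upwards [eventually_ge_atTop 0] with n hn
  rw [invEuler, if_neg (by omega)]

variable {z : ℝ} {t : ℤ → ℝ}

/-- The finite form of the Jacobi triple product identity. -/
theorem hasSum_finite_tripleProduct (h0 : 0 < x) (h1 : x < 1) (hz : z ≠ 0) (ht0 : t 0 = 1)
    (ht : ∀ m, t (m + 1) = -(z * x ^ m) * t m) (n : ℕ) :
    HasSum (fun m => t m * (invEuler x (n - m) * invEuler x (n + m)))
      ((∏ i ∈ Finset.range n, (1 - z * x ^ i)) * (∏ i ∈ Finset.range n, (1 - x / z * x ^ i)) /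
        eulerPoly (2 * n) x) := by
  induction n with
  | zero =>
    have h : t 0 * (invEuler x ((0 : ℕ) - 0) * invEuler x ((0 : ℕ) + 0)) = 1 := by
      simp [ht0, invEuler]
    simp only [Finset.range_zero, Finset.prod_empty, mul_zero, eulerPoly_zero, div_one, mul_one]
    rw [← h]
    refine hasSum_single _ fun m hm => ?_
    rcases lt_or_gt_of_ne hm with h | h
    · rw [invEuler_of_neg x (n := _ + m) (by push_cast; omega), mul_zero, mul_zero]
    · rw [invEuler_of_neg x (n := _ - m) (by push_cast; omega), zero_mul, mul_zero]
  | succ n ih =>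
    have ihm := (Equiv.subRight (1 : ℤ)).hasSum_iff.2 ih
    have ihp := (Equiv.addRight (1 : ℤ)).hasSum_iff.2 ih
    have hs := fun n => (one_sub_pow_succ_pos h0.le h1 n).ne'
    have hE := (eulerPoly_pos h0.le h1 (2 * n)).ne'
    have hx := h0.ne'
    -- The two new factors multiply to `1 + x^(2n+1) - z x^n - x^(n+1)/z`; the last two summands act
    -- on the series shifted by one to either side.
    have comb := (((ih.mul_left (1 + x ^ (2 * n + 1))).sub (ihm.mul_left (z * x ^ n))).sub
      (ihp.mul_left (x ^ (n + 1) / z))).div_const ((1 - x ^ (2 * n + 1)) * (1 - x ^ (2 * n + 2)))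
    convert comb using 1
    · rfl
    · funext m
      simp only [Function.comp_apply, Equiv.subRight_apply, Equiv.coe_addRight]
      have e1 := invEuler_sub_one h0.le h1 (n + 1 - m)
      have e2 := invEuler_sub_one h0.le h1 (n + 1 + m)
      have e3 := invEuler_sub_one h0.le h1 (n - m)
      have e4 := invEuler_sub_one h0.le h1 (n + m)
      have tp := ht m
      have tm := ht (m - 1)
      rw [sub_add_cancel] at tm
      rw [show (n : ℤ) + 1 - m - 1 = n - m by ring] at e1
      rw [show (n : ℤ) + 1 + m - 1 = n + m by ring] at e2
      rw [show (n : ℤ) - (m - 1) = n + 1 - m by ring, show (n : ℤ) + (m - 1) = n + m - 1 by ring,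
        show (n : ℤ) - (m + 1) = n - m - 1 by ring, show (n : ℤ) + (m + 1) = n + 1 + m by ring,
        e3, e4, e1, e2, tp, tm]
      push_cast
      generalize invEuler x (n + 1 - m) = I
      generalize invEuler x (n + 1 + m) = J
      generalize t (m - 1) = T
      have h1 := hs (2 * n)
      have h2 : 1 - x ^ (2 * n + 2) ≠ 0 := hs (2 * n + 1)
      have e5 : x ^ (2 * n + 1) = x ^ n * x ^ n * x := by ring
      have e6 : x ^ (2 * n + 2) = x ^ n * x ^ n * x * x := by ring
      rw [e5] at h1 ⊢
      rw [e6] at h2 ⊢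
      simp only [zpow_sub₀ hx, zpow_add₀ hx, zpow_one, zpow_natCast, pow_succ]
      have hm : x ^ m ≠ 0 := zpow_ne_zero m hx
      have hn : x ^ n ≠ 0 := pow_ne_zero n hx
      generalize x ^ m = B at *
      generalize x ^ n = A at *
      rw [eq_div_iff (mul_ne_zero h1 h2)]
      field_simp
      ring
    · rw [Finset.prod_range_succ, Finset.prod_range_succ, show 2 * (n + 1) = 2 * n + 1 + 1 by ring,
        eulerPoly_succ, eulerPoly_succ]
      have := hs (2 * n)
      have : 1 - x ^ (2 * n + 2) ≠ 0 := hs (2 * n + 1)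
      field_simp
      ring

theorem summable_theta (h0 : 0 < x) (h1 : x < 1) (hz : z ≠ 0) (ht0 : t 0 = 1)
    (ht : ∀ m, t (m + 1) = -(z * x ^ m) * t m) : Summable t := by
  have hx := h0.ne'
  have hlim : Tendsto (fun n : ℕ => x ^ n) atTop (𝓝 0) :=
    tendsto_pow_atTop_nhds_zero_of_lt_one h0.le h1
  have ratio : ∀ (f : ℕ → ℝ) (c : ℝ), f 0 ≠ 0 → c ≠ 0 →
      (∀ n, f (n + 1) = -(c * x ^ n) * f n) → Summable f := by
    intro f c hf0 hc hf
    have hne : ∀ n, f n ≠ 0 := by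
      intro n
      induction n with
      | zero => exact hf0
      | succ n ih =>
        rw [hf]
        exact mul_ne_zero (neg_ne_zero.2 (mul_ne_zero hc (pow_ne_zero n hx))) ih
    refine summable_of_ratio_test_tendsto_lt_one (l := 0) one_pos
      (Eventually.of_forall hne) ?_
    have : (fun n => ‖f (n + 1)‖ / ‖f n‖) = fun n => |c| * x ^ n := by
      funext n
      rw [hf, norm_mul, mul_div_assoc, div_self (norm_ne_zero_iff.2 (hne n)), mul_one, norm_neg,
        norm_mul, Real.norm_eq_abs, norm_pow, Real.norm_of_nonneg h0.le]
    rw [this]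
    simpa using hlim.const_mul |c|
  refine Summable.of_nat_of_neg_add_one (ratio _ z (by simp [ht0]) hz fun n => ?_)
    -- Solving the recurrence backwards gives `t (-(n+2)) = -(x^2/z) x^n t (-(n+1))`, so the
    -- negative half has the same shape with `z` replaced by `x^2/z`.
    (ratio _ (x ^ 2 / z) ?_ (div_ne_zero (pow_ne_zero 2 hx) hz) fun n => ?_)
  · have := ht n
    rw [zpow_natCast] at this
    exact_mod_cast this
  · intro h
    have := ht (-1)
    simp only [CharP.cast_eq_zero, zero_add] at h
    rw [h, mul_zero, neg_add_cancel, ht0] at this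
    exact one_ne_zero this
  · have := ht (-((n : ℤ) + 1) - 1)
    rw [sub_add_cancel] at this
    rw [this]
    push_cast
    rw [show -((n : ℤ) + 1 + 1) = -((n : ℤ) + 1) - 1 by ring, zpow_sub₀ hx, zpow_neg,
      zpow_add₀ hx, zpow_natCast]
    have : x ^ n ≠ 0 := pow_ne_zero n hx
    field_simp

/-- The Jacobi triple product identity. -/
theorem hasSum_tripleProduct (h0 : 0 < x) (h1 : x < 1) (hz : z ≠ 0) (ht0 : t 0 = 1)
    (ht : ∀ m, t (m + 1) = -(z * x ^ m) * t m) :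
    HasSum t (eulerInf x * ((∏' n : ℕ, (1 - z * x ^ n)) * ∏' n : ℕ, (1 - x / z * x ^ n))) := by
  have hs := summable_theta h0 h1 hz ht0 ht
  have hE := eulerInf_pos h0.le h1
  -- The finite identity is evaluated as `n → ∞` in two ways: termwise on the side of the sum, and
  -- through the convergent products on the other.
  have lim1 : Tendsto (fun n : ℕ => ∑' m, t m * (invEuler x (n - m) * invEuler x (n + m))) atTop
      (𝓝 (∑' m, t m * (1 / eulerInf x * (1 / eulerInf x)))) := by
    refine tendsto_tsum_of_dominated_convergence
      (bound := fun m => |t m| * (1 / eulerInf x * (1 / eulerInf x))) (hs.abs.mul_right _) ?_ ?_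
    · intro m
      refine (Tendsto.mul ?_ ?_).const_mul _
      · exact (tendsto_invEuler h0.le h1).comp
          (tendsto_atTop_add_const_right _ (-m) tendsto_natCast_atTop_atTop)
      · exact (tendsto_invEuler h0.le h1).comp
          (tendsto_atTop_add_const_right _ m tendsto_natCast_atTop_atTop)
    · refine Eventually.of_forall fun n m => ?_
      rw [norm_mul, Real.norm_eq_abs, Real.norm_of_nonneg
        (mul_nonneg (invEuler_nonneg h0.le h1 _) (invEuler_nonneg h0.le h1 _))]
      have := invEuler_nonneg h0.le h1 (n + m)
      have := invEuler_le h0.le h1 (n + m)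
      have := invEuler_le h0.le h1 (n - m)
      gcongr
  have lim2 : Tendsto (fun n : ℕ => ∑' m, t m * (invEuler x (n - m) * invEuler x (n + m))) atTop
      (𝓝 (((∏' n : ℕ, (1 - z * x ^ n)) * ∏' n : ℕ, (1 - x / z * x ^ n)) / eulerInf x)) := by
    simp only [fun n => (hasSum_finite_tripleProduct h0 h1 hz ht0 ht n).tsum_eq]
    refine Tendsto.div (Tendsto.mul ?_ ?_) ((tendsto_eulerPoly h0.le h1).comp
      (tendsto_id.const_mul_atTop' two_pos)) hE.ne'
    · exact (multipliable_one_sub (summable_mul_pow h0.le h1 z)).hasProd.tendsto_prod_nat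
    · exact (multipliable_one_sub (summable_mul_pow h0.le h1 (x / z))).hasProd.tendsto_prod_nat
  have := tendsto_nhds_unique lim1 lim2
  rw [tsum_mul_right] at this
  rw [hs.hasSum_iff]
  have := hE.ne'
  field_simp at *
  linarith

end TripleProduct

/-! ### The product side as a theta series -/

section ProductSide

variable {x : ℝ}

theorem pow_modulus_lt_one (h0 : 0 ≤ x) (h1 : x < 1) (r : ℕ) : x ^ (2 * r + 3) < 1 :=
  pow_lt_one₀ h0 h1 (by omega)

theorem mem_range_residue {M a j : ℕ} (ha : 0 < a) (haM : a ≤ M) :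
    j ∈ Set.range (fun n => M * n + a) ↔ 0 < j ∧ (j : ℤ) ≡ a [ZMOD M] := by
  constructor
  · rintro ⟨n, rfl⟩
    exact ⟨by positivity, (Int.modEq_iff_dvd.2 ⟨n, by push_cast; ring⟩).symm⟩
  · rintro ⟨hj, h⟩
    obtain ⟨k, hk⟩ := Int.modEq_iff_dvd.1 h.symm
    have : 0 ≤ k := by
      by_contra hneg
      have : (M : ℤ) * k ≤ M * (-1) := by gcongr; omega
      omega
    lift k to ℕ using this
    exact ⟨k, by zify; linarith⟩

theorem hasProd_residue (h0 : 0 ≤ x) (h1 : x < 1) {M a : ℕ} (hM : M ≠ 0) :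
    HasProd ((fun j : ℕ => 1 - x ^ j) ∘ ((↑) : Set.range (fun n => M * n + a) → ℕ))
      (∏' n : ℕ, (1 - x ^ a * (x ^ M) ^ n)) := by
  have hinj : Function.Injective fun n => M * n + a := fun m n h => by
    simpa [hM] using h
  rw [show ((fun j : ℕ => 1 - x ^ j) ∘ ((↑) : Set.range (fun n => M * n + a) → ℕ)) =
    fun j : Set.range (fun n => M * n + a) => (fun j : ℕ => 1 - x ^ j) j from rfl,
    hinj.hasProd_range_iff (f := fun j : ℕ => 1 - x ^ j)]
  convert (multipliable_one_sub (summable_mul_pow (pow_nonneg h0 M)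
    (pow_lt_one₀ h0 h1 hM) (x ^ a))).hasProd using 2 with n
  simp only [Function.comp_apply]
  rw [← pow_mul, ← pow_add, add_comm]

theorem summable_pow_agProdIndex (h0 : 0 ≤ x) (h1 : x < 1) (r i : ℕ) :
    Summable fun j : AGProdIndex r i => x ^ (j : ℕ) :=
  (summable_geometric_of_lt_one h0 h1).comp_injective Subtype.val_injective

theorem pow_agProdIndex_lt_one (h0 : 0 ≤ x) (h1 : x < 1) (r i : ℕ) (j : AGProdIndex r i) :
    x ^ (j : ℕ) < 1 :=
  pow_lt_one₀ h0 h1 j.2.1.ne'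

theorem hasProd_agProd (h0 : 0 ≤ x) (h1 : x < 1) (r i : ℕ) :
    HasProd (fun j : AGProdIndex r i => geomFactor x j) (agProd r i x) :=
  (hasProd_one_div_one_sub (summable_pow_agProdIndex h0 h1 r i)
    (pow_agProdIndex_lt_one h0 h1 r i)).multipliable.hasProd

/-- The positive integers split into the residue classes of `0`, `i`, `-i` modulo `2r + 3` and the
index set of `agProd`; the bounds on `i` make the three classes distinct. Multiplying `1 - x^j` over
all of them gives `eulerInf x`. -/
theorem agProd_eq (h0 : 0 ≤ x) (h1 : x < 1) {r i i' : ℕ} (hi : 0 < i) (hir : i ≤ r + 1)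
    (hi' : i + i' = 2 * r + 3) :
    agProd r i x = eulerInf (x ^ (2 * r + 3)) * ((∏' n : ℕ, (1 - x ^ i * (x ^ (2 * r + 3)) ^ n)) *
      ∏' n : ℕ, (1 - x ^ i' * (x ^ (2 * r + 3)) ^ n)) / eulerInf x := by
  set M := 2 * r + 3 with hM
  have hMz : (M : ℤ) = 2 * r + 3 := by rw [hM]; push_cast; ring
  have hsum := summable_pow_agProdIndex h0 h1 r i
  have hlt := pow_agProdIndex_lt_one h0 h1 r i
  have hA : agProd r i x = 1 / ∏' j : AGProdIndex r i, (1 - x ^ (j : ℕ)) :=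
    (hasProd_one_div_one_sub hsum hlt).tprod_eq
  have hP : HasProd ((fun j : ℕ => 1 - x ^ j) ∘ ((↑) : AGProdIndex r i → ℕ))
    (∏' j : AGProdIndex r i, (1 - x ^ (j : ℕ))) := (multipliable_one_sub hsum).hasProd
  have hpos := tprod_one_sub_pos hsum hlt
  have hE := eulerInf_pos h0 h1
  have hM0 : M ≠ 0 := by omega
  have r0 := hasProd_residue h0 h1 (a := M) hM0
  have r1 := hasProd_residue h0 h1 (a := i) hM0
  have r2 := hasProd_residue h0 h1 (a := i') hM0
  -- Modulus `1` with residue `1` is the class of all positive integers, so Euler's product has the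
  -- same form as the others.
  have rall := hasProd_residue h0 h1 (a := 1) (M := 1) one_ne_zero
  have m0 := fun j => mem_range_residue (j := j) (M := M) (a := M) (by omega) le_rfl
  have m1 := fun j => mem_range_residue (j := j) (M := M) (a := i) hi (by omega)
  have m2 := fun j => mem_range_residue (j := j) (M := M) (a := i') (by omega) (by omega)
  have mall := fun j => mem_range_residue (j := j) (M := 1) (a := 1) one_pos le_rfl
  have c0 : (M : ℤ) ≡ 0 [ZMOD M] := Int.modEq_zero_iff_dvd.2 dvd_rfl
  have c2 : (i' : ℤ) ≡ -i [ZMOD M] := by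
    refine (Int.modEq_iff_dvd.2 ⟨1, ?_⟩).symm
    have : (i : ℤ) + i' = M := by exact_mod_cast hi'
    linarith
  have n01 : ¬ (0 : ℤ) ≡ i [ZMOD M] := fun h => by
    have := Int.le_of_dvd (by omega) (Int.modEq_iff_dvd.1 h)
    omega
  have n02 : ¬ (0 : ℤ) ≡ -i [ZMOD M] := fun h => by
    have := Int.le_of_dvd (by omega) (Int.modEq_iff_dvd.1 h.symm)
    omega
  have n12 : ¬ (-i : ℤ) ≡ i [ZMOD M] := fun h => by
    have := Int.le_of_dvd (by omega) (Int.modEq_iff_dvd.1 h)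
    omega
  have d1 : Disjoint (Set.range fun n => M * n + M) (Set.range fun n => M * n + i) := by
    rw [Set.disjoint_left]
    intro j hj hj'
    exact n01 ((c0.symm.trans ((m0 j).1 hj).2.symm).trans ((m1 j).1 hj').2)
  have d2 : Disjoint (Set.range (fun n => M * n + M) ∪ Set.range fun n => M * n + i)
      (Set.range fun n => M * n + i') := by
    rw [Set.disjoint_left]
    rintro j (hj | hj) hj'
    · exact n02 ((c0.symm.trans ((m0 j).1 hj).2.symm).trans (((m2 j).1 hj').2.trans c2))
    · exact n12 ((c2.symm.trans ((m2 j).1 hj').2.symm).trans ((m1 j).1 hj).2)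
  have d3 : Disjoint ((Set.range (fun n => M * n + M) ∪ Set.range fun n => M * n + i) ∪
      Set.range fun n => M * n + i') {j : ℕ | 0 < j ∧ ¬ (j : ℤ) ≡ 0 [ZMOD (2 * r + 3)] ∧
        ¬ (j : ℤ) ≡ i [ZMOD (2 * r + 3)] ∧ ¬ (j : ℤ) ≡ -i [ZMOD (2 * r + 3)]} := by
    rw [Set.disjoint_left, ← hMz]
    rintro j ((hj | hj) | hj) ⟨_, h0, h1, h2⟩
    · exact h0 (((m0 j).1 hj).2.trans c0)
    · exact h1 ((m1 j).1 hj).2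
    · exact h2 (((m2 j).1 hj).2.trans c2)
  have tot := ((r0.mul_disjoint d1 r1).mul_disjoint d2 r2).mul_disjoint d3 hP
  rw [show ((Set.range (fun n => M * n + M) ∪ Set.range fun n => M * n + i) ∪
      Set.range fun n => M * n + i') ∪ {j : ℕ | 0 < j ∧ ¬ (j : ℤ) ≡ 0 [ZMOD (2 * r + 3)] ∧
        ¬ (j : ℤ) ≡ i [ZMOD (2 * r + 3)] ∧ ¬ (j : ℤ) ≡ -i [ZMOD (2 * r + 3)]} =
      Set.range fun n => 1 * n + 1 by
    ext j
    rw [← hMz, Set.mem_union, Set.mem_union, Set.mem_union, m0, m1, m2, mall, Set.mem_ofPred_eq]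
    have e0 : (j : ℤ) ≡ M [ZMOD M] ↔ (j : ℤ) ≡ 0 [ZMOD M] :=
      ⟨fun h => h.trans c0, fun h => h.trans c0.symm⟩
    have e2 : (j : ℤ) ≡ i' [ZMOD M] ↔ (j : ℤ) ≡ -i [ZMOD M] :=
      ⟨fun h => h.trans c2, fun h => h.trans c2.symm⟩
    have e1 : (j : ℤ) ≡ (1 : ℕ) [ZMOD (1 : ℕ)] := by simpa using Int.modEq_one
    rw [e0, e2]
    tauto] at tot
  have hval := tot.unique rall
  have hs0 : (∏' n : ℕ, (1 - x ^ M * (x ^ M) ^ n)) = eulerInf (x ^ M) :=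
    tprod_congr fun n => by rw [pow_succ' (x ^ M)]
  have hs1 : (∏' n : ℕ, (1 - x ^ 1 * (x ^ 1) ^ n)) = eulerInf x :=
    tprod_congr fun n => by rw [pow_one, pow_succ']
  rw [hs0, hs1] at hval
  rw [hA, div_eq_div_iff hpos.ne' hE.ne', ← hval]
  ring

/-- The first member of the `r`-th Bailey pair in the chain that starts from the unit pair. -/
noncomputable def chainAlpha (x : ℝ) (e r : ℕ) (m : ℕ) : ℝ :=
  x ^ (r * (m ^ 2 + e * m)) * if e = 0 then unitBaileyZero x m else unitBaileyOne x m

/-- The general term of the theta series behind the product side. -/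
noncomputable def thetaTerm (x : ℝ) (e r : ℕ) (m : ℤ) : ℝ :=
  (-1) ^ m * x ^ (r * (m ^ 2 + e * m) + m * (m - 1) / 2)

theorem int_triangle_succ (m : ℤ) : (m + 1) * (m + 1 - 1) / 2 = m * (m - 1) / 2 + m := by
  rw [show (m + 1) * (m + 1 - 1) = m * (m - 1) + m * 2 by ring,
    Int.add_mul_ediv_right _ _ two_ne_zero]

theorem int_triangle_neg (m : ℤ) : (-m) * (-m - 1) / 2 = m * (m - 1) / 2 + m := by
  rw [← int_triangle_succ]; congr 1; ring

theorem thetaTerm_succ (h0 : 0 < x) (e r : ℕ) (m : ℤ) :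
    thetaTerm x e (r + 1) (m + 1) =
      -(x ^ ((r + 1) * (1 + e)) * (x ^ (2 * r + 3)) ^ m) * thetaTerm x e (r + 1) m := by
  have hx := h0.ne'
  rw [thetaTerm, thetaTerm, int_triangle_succ, zpow_add_one₀ (by norm_num), ← zpow_natCast,
    ← zpow_natCast, ← zpow_mul, ← zpow_add₀ hx, mul_neg_one, neg_mul, neg_mul, mul_left_comm,
    ← zpow_add₀ hx]
  push_cast
  congr 3
  ring

theorem nat_triangle_cast (m : ℕ) : ((m * (m - 1) / 2 : ℕ) : ℤ) = (m : ℤ) * (m - 1) / 2 := by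
  cases m with
  | zero => simp
  | succ m => push_cast; simp

theorem thetaTerm_natCast (x : ℝ) (e r m : ℕ) :
    thetaTerm x e r m = (-1) ^ m * (x ^ (r * (m ^ 2 + e * m)) * x ^ (m * (m - 1) / 2)) := by
  rw [thetaTerm, ← nat_triangle_cast, ← pow_add, zpow_natCast, ← zpow_natCast x]
  push_cast
  rfl

/-- The indices `m` and `-m` together produce the factor `1 + x^m` of `unitBaileyZero`. For `e = 1`
the partner of `m` is `-(m + 1)`, and the pair produces `1 - x^(2m+1)`. -/
theorem thetaTerm_zero_neg (h0 : 0 < x) (r : ℕ) (m : ℤ) :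
    thetaTerm x 0 r (-m) = thetaTerm x 0 r m * x ^ m := by
  rw [thetaTerm, thetaTerm, int_triangle_neg, mul_assoc, ← zpow_add₀ h0.ne', zpow_neg,
    ← inv_zpow, inv_neg_one]
  congr 2
  push_cast
  ring

theorem thetaTerm_one_neg (h0 : 0 < x) (r : ℕ) (m : ℤ) :
    thetaTerm x 1 r (-(m + 1)) = -(thetaTerm x 1 r m * x ^ (2 * m + 1)) := by
  rw [thetaTerm, thetaTerm, int_triangle_neg, int_triangle_succ, mul_assoc, ← zpow_add₀ h0.ne',
    zpow_neg, ← inv_zpow, inv_neg_one, zpow_add_one₀ (by norm_num), mul_neg_one, neg_mul]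
  congr 3
  push_cast
  ring

theorem hasSum_chainAlpha_zero (h0 : 0 < x) (r : ℕ) {s : ℝ}
    (hs : HasSum (thetaTerm x 0 r) s) : HasSum (chainAlpha x 0 r) s := by
  -- Folding counts the index `0` twice; removing one copy matches the value `1` of the unit pair at
  -- `0`.
  have h := hs.nat_add_neg.sub (hasSum_ite_eq (0 : ℕ) (thetaTerm x 0 r 0))
  rw [add_sub_cancel_right] at h
  convert h using 1
  · rfl
  funext m
  rw [thetaTerm_zero_neg h0, zpow_natCast, thetaTerm_natCast, chainAlpha, if_pos rfl,
    unitBaileyZero]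
  split_ifs with hm
  · simp [hm, thetaTerm]
  · ring

theorem hasSum_chainAlpha_one (h0 : 0 < x) (r : ℕ) {s : ℝ}
    (hs : HasSum (thetaTerm x 1 r) s) : HasSum (chainAlpha x 1 r) s := by
  convert hs.nat_add_neg_add_one using 1
  funext m
  rw [thetaTerm_one_neg h0, thetaTerm_natCast, chainAlpha, if_neg one_ne_zero, unitBaileyOne,
    show (2 * (m : ℤ) + 1) = (2 * m + 1 : ℕ) by push_cast; rfl, zpow_natCast]
  ring

/-- The residue that belongs to the chain starting from the unit Bailey pair relative to
`x ^ e`. -/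
def chainResidue (e r : ℕ) : ℕ := if e = 0 then r + 1 else 1

/-- This is the triple product with base `x^(2r+3)` and `z = x^((r+1)(1+e))`. The exponents of `z`
and of base over `z` are `r + 1`, `r + 2` for `e = 0` and `2r + 2`, `1` for `e = 1`, the residues
`±i` in both cases. -/
theorem hasSum_chainAlpha (h0 : 0 < x) (h1 : x < 1) {e : ℕ} (he : e ≤ 1) (r : ℕ) :
    HasSum (chainAlpha x e (r + 1)) (agProd r (chainResidue e r) x * eulerInf x) := by
  have hE := (eulerInf_pos h0.le h1).ne'
  have ht := hasSum_tripleProduct (z := x ^ ((r + 1) * (1 + e))) (pow_pos h0 _)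
    (pow_modulus_lt_one h0.le h1 r) (pow_ne_zero _ h0.ne') (t := thetaTerm x e (r + 1))
    (by simp [thetaTerm]) (thetaTerm_succ h0 e r)
  have hz : ∀ a b c : ℕ, c = a + b → x ^ c / x ^ a = x ^ b := fun a b c h => by
    rw [h, pow_add, mul_div_cancel_left₀ _ (pow_ne_zero _ h0.ne')]
  obtain rfl | rfl : e = 0 ∨ e = 1 := by omega
  · rw [show chainResidue 0 r = r + 1 from rfl,
      agProd_eq (i' := r + 2) h0.le h1 (by omega) le_rfl (by omega), div_mul_cancel₀ _ hE]
    rw [show (r + 1) * (1 + 0) = r + 1 by ring, hz (r + 1) (r + 2) _ (by ring)] at ht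
    exact hasSum_chainAlpha_zero h0 _ ht
  · rw [show chainResidue 1 r = 1 from rfl,
      agProd_eq (i' := 2 * r + 2) h0.le h1 (by omega) (by omega) (by omega), div_mul_cancel₀ _ hE]
    rw [show (r + 1) * (1 + 1) = 2 * r + 2 by ring, hz (2 * r + 2) 1 _ (by ring),
      mul_comm (∏' n : ℕ, _) (∏' n : ℕ, _)] at ht
    exact hasSum_chainAlpha_one h0 _ ht

theorem chainAlpha_succ (x : ℝ) (e r : ℕ) :
    chainAlpha x e (r + 1) = fun m => x ^ (m ^ 2 + e * m) * chainAlpha x e r m := by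
  funext m
  rw [chainAlpha, chainAlpha, ← mul_assoc, ← pow_add]
  congr 2
  ring

theorem baileySum_chainAlpha_zero (h0 : 0 ≤ x) (h1 : x < 1) {e : ℕ} (he : e ≤ 1) (n : ℕ) :
    baileySum x e (chainAlpha x e 0) n = if n = 0 then 1 else 0 := by
  obtain rfl | rfl : e = 0 ∨ e = 1 := by omega
  · rw [← baileySum_unitBaileyZero h0 h1]; congr; funext m; simp [chainAlpha]
  · rw [← baileySum_unitBaileyOne h0 h1]; congr; funext m; simp [chainAlpha]

theorem baileySum_chainAlpha_succ (h0 : 0 ≤ x) (h1 : x < 1) (e r n : ℕ) :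
    baileySum x e (chainAlpha x e (r + 1)) n =
      ∑ s ∈ Finset.range (n + 1), x ^ (s ^ 2 + e * s) / eulerPoly (n - s) x *
        baileySum x e (chainAlpha x e r) s := by
  rw [chainAlpha_succ, baileySum_step h0 h1]

theorem baileySum_chainAlpha_one (h0 : 0 ≤ x) (h1 : x < 1) {e : ℕ} (he : e ≤ 1) (n : ℕ) :
    baileySum x e (chainAlpha x e 1) n = 1 / eulerPoly n x := by
  rw [baileySum_chainAlpha_succ h0 h1, Finset.sum_eq_single 0]
  · simp [baileySum_chainAlpha_zero h0 h1 he]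
  · intro s _ hs
    rw [baileySum_chainAlpha_zero h0 h1 he, if_neg hs, mul_zero]
  · simp

theorem baileySum_chainAlpha_nonneg (h0 : 0 ≤ x) (h1 : x < 1) {e : ℕ} (he : e ≤ 1) (r n : ℕ) :
    0 ≤ baileySum x e (chainAlpha x e r) n := by
  induction r generalizing n with
  | zero => rw [baileySum_chainAlpha_zero h0 h1 he]; split_ifs <;> norm_num
  | succ r ih =>
    rw [baileySum_chainAlpha_succ h0 h1]
    exact Finset.sum_nonneg fun s _ => mul_nonneg (div_nonneg (pow_nonneg h0 _)
      (eulerPoly_pos h0 h1 _).le) (ih s)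

end ProductSide

/-! ### The multiple sum and the Andrews-Gordon identity -/

section SumSide

variable {x : ℝ}

theorem hasSum_prod_of_nonneg {β γ : Type*} {f : β × γ → ℝ} {g : β → ℝ} {a : ℝ}
    (hf : ∀ q, 0 ≤ f q) (h : ∀ b, HasSum (fun c => f (b, c)) (g b)) (hg : HasSum g a) :
    HasSum f a := by
  have hs : Summable f := (summable_prod_of_nonneg hf).2
    ⟨fun b => (h b).summable, by simpa only [fun b => (h b).tsum_eq] using hg.summable⟩
  rw [← (hs.hasSum.prod_fiberwise h).unique hg]
  exact hs.hasSum

/-- The general term of the left side, for both linear parts of the exponent at once. -/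
noncomputable def chainTerm (x : ℝ) (e : ℕ) {r : ℕ} (k : Fin r → ℕ) : ℝ :=
  x ^ (∑ j, (k j ^ 2 + e * k j)) / ∏ j, eulerPoly (k j - nextPart k j) x

theorem agTerm_chainResidue (x : ℝ) {e : ℕ} (he : e ≤ 1) {r : ℕ} (k : Fin r → ℕ) :
    agTerm r (chainResidue e r) x k = chainTerm x e k := by
  rw [agTerm, chainTerm, Finset.sum_add_distrib]
  congr 3
  obtain rfl | rfl : e = 0 ∨ e = 1 := by omega
  · rw [show chainResidue 0 r = r + 1 from rfl, Finset.filter_eq_empty_iff.2]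
    · simp
    · intro j _; omega
  · rw [show chainResidue 1 r = 1 from rfl, Finset.filter_true_of_mem]
    · simp
    · intro j _; omega

/-- The first part of `k`, which is zero for the empty sequence. -/
def firstPart {r : ℕ} (k : Fin r → ℕ) : ℕ := if h : 0 < r then k ⟨0, h⟩ else 0

theorem firstPart_cons {r : ℕ} (s : ℕ) (k : Fin r → ℕ) :
    firstPart (Fin.cons s k : Fin (r + 1) → ℕ) = s := by
  simp [firstPart]

theorem nextPart_cons_zero {r : ℕ} (s : ℕ) (k : Fin r → ℕ) :
    nextPart (Fin.cons s k : Fin (r + 1) → ℕ) 0 = firstPart k := by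
  unfold nextPart firstPart
  by_cases h : 0 < r
  · rw [dif_pos (by simpa using h), dif_pos h]
    exact Fin.cons_succ (α := fun _ => ℕ) s k ⟨0, h⟩
  · rw [dif_neg (by simpa using h), dif_neg h]

theorem nextPart_cons_succ {r : ℕ} (s : ℕ) (k : Fin r → ℕ) (j : Fin r) :
    nextPart (Fin.cons s k : Fin (r + 1) → ℕ) j.succ = nextPart k j := by
  unfold nextPart
  by_cases h : (j : ℕ) + 1 < r
  · rw [dif_pos (by simpa using h), dif_pos h]
    exact Fin.cons_succ (α := fun _ => ℕ) s k ⟨j + 1, h⟩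
  · rw [dif_neg (by simpa using h), dif_neg h]

theorem antitone_cons_iff {r : ℕ} (s : ℕ) (k : Fin r → ℕ) :
    Antitone (Fin.cons s k : Fin (r + 1) → ℕ) ↔ Antitone k ∧ firstPart k ≤ s := by
  constructor
  · intro h
    refine ⟨fun i j hij => ?_, ?_⟩
    · simpa using h (Fin.succ_le_succ_iff.2 hij)
    · rw [firstPart]
      split_ifs with hr
      · have := h (Fin.zero_le (Fin.succ ⟨0, hr⟩))
        rwa [Fin.cons_succ, Fin.cons_zero] at this
      · exact Nat.zero_le _
  · rintro ⟨hk, hs⟩ i j hij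
    induction i using Fin.cases with
    | zero =>
      induction j using Fin.cases with
      | zero => rfl
      | succ j =>
        have hr : 0 < r := j.pos
        rw [firstPart, dif_pos hr] at hs
        simpa using (hk (show (⟨0, hr⟩ : Fin r) ≤ j from Nat.zero_le _)).trans hs
    | succ i =>
      induction j using Fin.cases with
      | zero => exact absurd hij (by simp)
      | succ j => simpa using hk (Fin.succ_le_succ_iff.1 hij)

/-- Removing the first part reproduces the recursion of `baileySum_step`, with `s` in the role of
the bound for the remaining parts. -/
theorem chainTerm_cons (x : ℝ) (e : ℕ) {r : ℕ} (s : ℕ) (k : Fin r → ℕ) :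
    chainTerm x e (Fin.cons s k : Fin (r + 1) → ℕ) =
      x ^ (s ^ 2 + e * s) * (chainTerm x e k / eulerPoly (s - firstPart k) x) := by
  rw [chainTerm, chainTerm, Fin.sum_univ_succ, Fin.prod_univ_succ, pow_add]
  simp only [nextPart_cons_zero, nextPart_cons_succ, Fin.cons_zero, Fin.cons_succ]
  rw [mul_div_mul_comm]
  ring

theorem chainTerm_nonneg (h0 : 0 ≤ x) (h1 : x < 1) (e : ℕ) {r : ℕ} (k : Fin r → ℕ) :
    0 ≤ chainTerm x e k :=
  div_nonneg (pow_nonneg h0 _) (Finset.prod_nonneg fun _ _ => (eulerPoly_pos h0 h1 _).le)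

open Classical in
/-- The general term with an additional part `n` in front. -/
noncomputable def boundedTerm (x : ℝ) (e : ℕ) {r : ℕ} (n : ℕ) (k : Fin r → ℕ) : ℝ :=
  if Antitone k ∧ firstPart k ≤ n then chainTerm x e k / eulerPoly (n - firstPart k) x else 0

theorem boundedTerm_nonneg (h0 : 0 ≤ x) (h1 : x < 1) (e : ℕ) {r : ℕ} (n : ℕ) (k : Fin r → ℕ) :
    0 ≤ boundedTerm x e n k := by
  rw [boundedTerm]
  split_ifs
  · exact div_nonneg (chainTerm_nonneg h0 h1 e k) (eulerPoly_pos h0 h1 _).le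
  · rfl

/-- The weight `w` is left free because two cases are needed: the truncated weight `1 / f_{n-s}` for
a bounded first part, and the constant `1` for an unbounded one. -/
theorem hasSum_boundedTerm_cons (h0 : 0 ≤ x) (h1 : x < 1) {e r : ℕ} {b w : ℕ → ℝ} {a : ℝ}
    (hw : ∀ s, 0 ≤ w s) (hb : ∀ s, HasSum (fun k : Fin r → ℕ => boundedTerm x e s k) (b s))
    (ha : HasSum (fun s => w s * x ^ (s ^ 2 + e * s) * b s) a) {f : (Fin (r + 1) → ℕ) → ℝ}
    (hf : ∀ s (k : Fin r → ℕ), f (Fin.cons s k : Fin (r + 1) → ℕ) =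
      w s * x ^ (s ^ 2 + e * s) * boundedTerm x e s k) : HasSum f a := by
  have hf' : ∀ q, f (Fin.consEquiv (fun _ => ℕ) q) =
    w q.1 * x ^ (q.1 ^ 2 + e * q.1) * boundedTerm x e q.1 q.2 := fun q => hf q.1 q.2
  rw [← (Fin.consEquiv fun _ => ℕ).hasSum_iff]
  refine hasSum_prod_of_nonneg (fun q => ?_) (fun s => ?_) ha
  · simp only [Function.comp_apply, hf']
    exact mul_nonneg (mul_nonneg (hw _) (pow_nonneg h0 _)) (boundedTerm_nonneg h0 h1 e _ _)
  · simp only [Function.comp_apply, hf']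
    exact (hb s).mul_left _

/-- Each step of the Bailey chain contributes one part. The empty sequence corresponds to the first
step, where `β_n = 1 / f_n`, hence the index `r + 1`. -/
theorem hasSum_boundedTerm (h0 : 0 ≤ x) (h1 : x < 1) {e : ℕ} (he : e ≤ 1) (r n : ℕ) :
    HasSum (fun k : Fin r → ℕ => boundedTerm x e n k)
      (baileySum x e (chainAlpha x e (r + 1)) n) := by
  induction r generalizing n with
  | zero =>
    rw [baileySum_chainAlpha_one h0 h1 he]
    convert hasSum_fintype (fun k : Fin 0 → ℕ => boundedTerm x e n k) using 1
    simp [boundedTerm, Subsingleton.antitone, firstPart, chainTerm]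
  | succ r ih =>
    refine hasSum_boundedTerm_cons h0 h1 (r := r)
      (w := fun s => if s ≤ n then 1 / eulerPoly (n - s) x else 0) (fun s => ?_) ih ?_ ?_
    · split_ifs
      · exact one_div_nonneg.2 (eulerPoly_pos h0 h1 _).le
      · rfl
    · rw [baileySum_chainAlpha_succ h0 h1]
      convert hasSum_sum_of_ne_finset_zero (s := Finset.range (n + 1)) ?_ using 1
      · refine Finset.sum_congr rfl fun s hs => ?_
        rw [if_pos (Nat.lt_succ_iff.1 (Finset.mem_range.1 hs))]
        ring
      · intro s hs
        rw [if_neg (by simpa [Nat.lt_succ_iff] using hs), zero_mul, zero_mul]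
      · infer_instance
    · intro s k
      simp only [boundedTerm, antitone_cons_iff, firstPart_cons, chainTerm_cons]
      by_cases hk : Antitone k ∧ firstPart k ≤ s <;> by_cases hn : s ≤ n <;>
        simp only [hk, hn, and_self, and_true, and_false, if_true, if_false, mul_zero, zero_mul]
      ring

/-- The limit of the next member of the chain is computed twice: `tendsto_baileySum` gives the
product over `eulerInf x`, and the recursion gives the series over `eulerInf x`. Summability holds
because a convergent sequence `b` is bounded. -/
theorem hasSum_pow_mul_baileySum (h0 : 0 < x) (h1 : x < 1) {e : ℕ} (he : e ≤ 1) (r : ℕ) :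
    HasSum (fun s => x ^ (s ^ 2 + e * s) * baileySum x e (chainAlpha x e (r + 1)) s)
      (agProd (r + 1) (chainResidue e (r + 1)) x) := by
  have hE := eulerInf_pos h0.le h1
  have lim := fun r => tendsto_baileySum h0.le h1 e (hasSum_chainAlpha h0 h1 he r).summable
  have lim1 := lim (r + 1)
  rw [(hasSum_chainAlpha h0 h1 he (r + 1)).tsum_eq, mul_div_mul_right _ _ hE.ne'] at lim1
  set b := baileySum x e (chainAlpha x e (r + 1)) with hbdef
  have hb := baileySum_chainAlpha_nonneg h0.le h1 he (r + 1)
  obtain ⟨C, hC⟩ := (lim r).bddAbove_range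
  have hC' : ∀ s, b s ≤ C := fun s => hC ⟨s, rfl⟩
  have hle : ∀ s, x ^ (s ^ 2 + e * s) * b s ≤ x ^ s * C := fun s => by
    have : x ^ (s ^ 2 + e * s) ≤ x ^ s :=
      pow_le_pow_of_le_one h0.le h1.le (le_add_right (Nat.le_self_pow two_ne_zero s))
    exact mul_le_mul this (hC' s) (hb s) (pow_nonneg h0.le _)
  have hnn : ∀ s, 0 ≤ x ^ (s ^ 2 + e * s) * b s := fun s => mul_nonneg (pow_nonneg h0.le _) (hb s)
  have hs : Summable fun s => x ^ (s ^ 2 + e * s) * b s :=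
    ((summable_geometric_of_lt_one h0.le h1).mul_right C).of_nonneg_of_le hnn hle
  have hsum : ∀ n, baileySum x e (chainAlpha x e (r + 1 + 1)) n = ∑' s, (if s < n + 1 then
      1 / eulerPoly (n - s) x * (x ^ (s ^ 2 + e * s) * b s) else 0) := by
    intro n
    rw [baileySum_chainAlpha_succ h0.le h1, tsum_eq_sum (s := Finset.range (n + 1))
      (fun m hm => if_neg (by simpa using hm))]
    refine Finset.sum_congr rfl fun m hm => ?_
    rw [if_pos (Finset.mem_range.1 hm), ← hbdef]
    ring
  have lim2 : Tendsto (baileySum x e (chainAlpha x e (r + 1 + 1))) atTop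
      (𝓝 (∑' s, 1 / eulerInf x * (x ^ (s ^ 2 + e * s) * b s))) := by
    rw [funext hsum]
    refine tendsto_tsum_of_dominated_convergence
      (bound := fun s => 1 / eulerInf x * (x ^ (s ^ 2 + e * s) * b s)) (hs.mul_left _) ?_ ?_
    · intro s
      refine Tendsto.congr' ?_ (((tendsto_const_nhds (x := (1 : ℝ))).div
        ((tendsto_eulerPoly h0.le h1).comp (tendsto_sub_atTop_nat s)) hE.ne').mul_const _)
      filter_upwards [eventually_ge_atTop s] with n hn
      simp [Nat.lt_succ_of_le hn]
    · refine Eventually.of_forall fun n s => ?_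
      split_ifs
      · rw [Real.norm_of_nonneg (mul_nonneg (one_div_nonneg.2 (eulerPoly_pos h0.le h1 _).le)
          (hnn s))]
        exact mul_le_mul_of_nonneg_right (one_div_eulerPoly_le h0.le h1 _) (hnn s)
      · rw [norm_zero]
        exact mul_nonneg (one_div_nonneg.2 hE.le) (hnn s)
  have := tendsto_nhds_unique lim1 lim2
  rw [tsum_mul_left, div_eq_inv_mul, one_div] at this
  rw [hs.hasSum_iff]
  exact (mul_left_cancel₀ (inv_ne_zero hE.ne') this).symm

/-- The Andrews-Gordon identity for the two extreme residues. -/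
theorem hasSum_agTerm (h0 : 0 < x) (h1 : x < 1) {e : ℕ} (he : e ≤ 1) {r : ℕ} (hr : 1 ≤ r) :
    HasSum (fun k : AGIndex r => agTerm r (chainResidue e r) x k)
      (agProd r (chainResidue e r) x) := by
  obtain ⟨r, rfl⟩ := Nat.exists_eq_add_of_le' hr
  classical
  have hfun : (fun k : AGIndex (r + 1) => agTerm (r + 1) (chainResidue e (r + 1)) x k) =
      (fun k => chainTerm x e k) ∘ ((↑) : AGIndex (r + 1) → Fin (r + 1) → ℕ) :=
    funext fun k => agTerm_chainResidue x he k.1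
  have hcons : ∀ s (k : Fin r → ℕ), Set.indicator {k : Fin (r + 1) → ℕ | Antitone k}
      (fun k => chainTerm x e k) (Fin.cons s k : Fin (r + 1) → ℕ) =
      1 * x ^ (s ^ 2 + e * s) * boundedTerm x e s k := by
    intro s k
    rw [Set.indicator_apply, boundedTerm, chainTerm_cons, one_mul]
    simp only [Set.mem_ofPred_eq, antitone_cons_iff, mul_ite, mul_zero]
  have hsum := hasSum_pow_mul_baileySum h0 h1 he r
  have h := hasSum_boundedTerm_cons h0.le h1 (w := fun _ => 1) (fun _ => zero_le_one)
    (hasSum_boundedTerm h0.le h1 he r) (by simpa only [one_mul] using hsum) hcons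
  rw [hfun]
  exact (hasSum_subtype_iff_indicator (s := {k : Fin (r + 1) → ℕ | Antitone k})).2 h

/-- In the theta series every term with `m > 0` carries a power of `x` whose exponent grows with
`r`, so only `m = 0` remains in the limit. The series for `r = 0` dominates. -/
theorem tendsto_agProd (h0 : 0 < x) (h1 : x < 1) {e : ℕ} (he : e ≤ 1) :
    Tendsto (fun r => agProd r (chainResidue e r) x) atTop
      (𝓝 (chainAlpha x e 0 0 / eulerInf x)) := by
  have hE := eulerInf_pos h0.le h1
  have hlim : Tendsto (fun r => ∑' m, chainAlpha x e (r + 1) m) atTop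
      (𝓝 (∑' m, if m = 0 then chainAlpha x e 0 0 else 0)) := by
    refine tendsto_tsum_of_dominated_convergence
      (hasSum_chainAlpha h0 h1 he 0).summable.abs ?_ ?_
    · intro m
      split_ifs with hm
      · simp [hm, chainAlpha]
      · have hlt : x ^ (m ^ 2 + e * m) < 1 := pow_lt_one₀ h0.le h1 (by positivity)
        have := ((tendsto_pow_atTop_nhds_zero_of_lt_one (pow_nonneg h0.le _) hlt).comp
          (tendsto_add_atTop_nat 1)).mul_const (chainAlpha x e 0 m)
        rw [zero_mul] at this
        refine this.congr fun r => ?_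
        simp only [Function.comp_apply]
        rw [chainAlpha, chainAlpha, zero_mul, pow_zero, one_mul, ← pow_mul]
        congr 2
        ring
    · refine Eventually.of_forall fun r m => ?_
      rw [Real.norm_eq_abs, chainAlpha, chainAlpha, abs_mul, abs_mul]
      refine mul_le_mul_of_nonneg_right ?_ (abs_nonneg _)
      rw [abs_of_pos (pow_pos h0 _), abs_of_pos (pow_pos h0 _)]
      exact pow_le_pow_of_le_one h0.le h1.le (Nat.mul_le_mul_right _ (by omega))
  rw [tsum_ite_eq] at hlim
  refine (hlim.div_const (eulerInf x)).congr fun r => ?_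
  rw [(hasSum_chainAlpha h0 h1 he r).tsum_eq, mul_div_cancel_right₀ _ hE.ne']

end SumSide

/-! ### Counting tuples with linearly independent images -/

section IndependentTuples

theorem AddMonoidHom.card_comap_of_le_range {D V : Type*} [AddGroup D] [AddGroup V] [Finite D]
    (φ : D →+ V) {W : AddSubgroup V} (hW : W ≤ φ.range) :
    Nat.card (W.comap φ) = Nat.card φ.ker * Nat.card W := by
  have hsurj : Function.Surjective (φ.addSubgroupComap W) := by
    rintro ⟨w, hw⟩
    obtain ⟨d, rfl⟩ := hW hw
    exact ⟨⟨d, hw⟩, rfl⟩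
  have h1 := (φ.addSubgroupComap W).ker.card_mul_index
  rw [AddSubgroup.index_ker, AddMonoidHom.range_eq_top.2 hsurj, AddSubgroup.card_top] at h1
  rw [← h1]
  congr 1
  refine Nat.card_congr ⟨fun d => ⟨d.1.1, congrArg Subtype.val d.2⟩,
    fun d => ⟨⟨d.1, by simp [(show φ d.1 = 0 from d.2), W.zero_mem]⟩,
      Subtype.ext d.2⟩, fun _ => rfl, fun _ => rfl⟩

variable {p : ℕ} [Fact p.Prime] {V : Type*} [AddCommGroup V] [Module (ZMod p) V] [Finite V]
  {D : ℕ → Type*} [∀ i, AddCommGroup (D i)] [∀ i, Finite (D i)]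

/-- The number of tuples with entries in given groups whose images in a vector space
are linearly independent, when the ranges of the maps to the vector space increase. -/
theorem card_linearIndependent_tuples (φ : ∀ i, D i →+ V) (n : ℕ)
    (hφ : ∀ i j, i ≤ j → j < n → (φ i).range ≤ (φ j).range) :
    Nat.card {g : ∀ i : Fin n, D i // LinearIndependent (ZMod p) fun i : Fin n => φ i (g i)} =
      ∏ i ∈ Finset.range n, (Nat.card (D i) - Nat.card (φ i).ker * p ^ i) := by
  classical
  induction n with
  | zero =>
    rw [Finset.range_zero, Finset.prod_empty, Nat.card_eq_one_iff_unique]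
    exact ⟨inferInstance, ⟨⟨fun i => i.elim0, linearIndependent_empty_type⟩⟩⟩
  | succ n ih =>
    have e : {g : ∀ i : Fin (n + 1), D i //
        LinearIndependent (ZMod p) fun i : Fin (n + 1) => φ i (g i)} ≃
        (g : {g : ∀ i : Fin n, D i // LinearIndependent (ZMod p) fun i : Fin n => φ i (g i)}) ×
          {d : D n // φ n d ∉ Submodule.span (ZMod p) (Set.range fun i : Fin n => φ i (g.1 i))} :=
      { toFun := fun g => ⟨⟨fun i => g.1 i.castSucc, ((linearIndependent_finSnoc
            (v := fun i : Fin n => φ i (g.1 i.castSucc)) (x := φ n (g.1 (Fin.last n)))).1 (by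
              convert g.2 using 1
              funext i
              induction i using Fin.lastCases <;> simp)).1⟩,
            ⟨g.1 (Fin.last n), ((linearIndependent_finSnoc
            (v := fun i : Fin n => φ i (g.1 i.castSucc)) (x := φ n (g.1 (Fin.last n)))).1 (by
              convert g.2 using 1
              funext i
              induction i using Fin.lastCases <;> simp)).2⟩⟩
        invFun := fun s => ⟨Fin.snoc (α := fun i : Fin (n + 1) => D i) s.1.1 s.2.1, by
          convert linearIndependent_finSnoc.2 ⟨s.1.2, s.2.2⟩ using 1
          funext i
          induction i using Fin.lastCases <;> simp⟩
        left_inv := fun g => by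
          ext i
          induction i using Fin.lastCases <;> simp
        right_inv := fun s => by
          refine Sigma.subtype_ext (Subtype.ext (funext fun i => ?_)) ?_ <;> simp }
    have fiber : ∀ g : {g : ∀ i : Fin n, D i //
        LinearIndependent (ZMod p) fun i : Fin n => φ i (g i)},
        Nat.card {d : D n // φ n d ∉
          Submodule.span (ZMod p) (Set.range fun i : Fin n => φ i (g.1 i))} =
        Nat.card (D n) - Nat.card (φ n).ker * p ^ n := by
      intro g
      set W := Submodule.span (ZMod p) (Set.range fun i : Fin n => φ i (g.1 i)) with hW
      have hWr : W.toAddSubgroup ≤ (φ n).range := by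
        have : W ≤ AddSubgroup.toZModSubmodule p (φ n).range := by
          rw [hW, Submodule.span_le]
          rintro _ ⟨i, rfl⟩
          exact hφ i n i.2.le n.lt_succ_self ⟨_, rfl⟩
        exact this
      have hcard : Nat.card W = p ^ n := by
        rw [Module.natCard_eq_pow_finrank (K := ZMod p), finrank_span_eq_card g.2, Nat.card_zmod,
          Fintype.card_fin]
      -- The excluded values of the last entry form the preimage of `W`. As `W` lies in the range,
      -- by monotonicity of the ranges, the preimage has `|ker| * p^n` elements whatever the earlier
      -- entries are.
      have h := (φ n).card_comap_of_le_range hWr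
      rw [show Nat.card W.toAddSubgroup = Nat.card W from rfl, hcard] at h
      rw [← h]
      have := Nat.card_congr (Equiv.sumCompl fun d : D n => φ n d ∈ W)
      rw [Nat.card_sum] at this
      exact Nat.eq_sub_of_add_eq' this
    have := Fintype.ofFinite {g : ∀ i : Fin n, D i //
      LinearIndependent (ZMod p) fun i : Fin n => φ i (g i)}
    rw [Nat.card_congr e, Nat.card_sigma, Finset.sum_congr rfl fun g _ => fiber g,
      Finset.sum_const, Finset.card_univ, ← Nat.card_eq_fintype_card,
      ih fun i j hij hj => hφ i j hij (by omega), Finset.prod_range_succ, smul_eq_mul]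

end IndependentTuples

/-! ### Torsion subgroups and their maps to the `p`-torsion -/

section TorsionSubgroups

variable (A : Type*) [AddCommGroup A] (p : ℕ)

/-- The elements killed by `p ^ a`. -/
abbrev powTorsion (a : ℕ) : AddSubgroup A := AddSubgroup.torsionBy A ((p ^ a : ℕ) : ℤ)

variable {A p}

theorem mem_powTorsion {a : ℕ} {x : A} : x ∈ powTorsion A p a ↔ p ^ a • x = 0 :=
  AddSubgroup.torsionBy.nsmul_iff

theorem mem_powTorsion_of_le {a b : ℕ} (h : a ≤ b) {x : A} (hx : x ∈ powTorsion A p a) :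
    x ∈ powTorsion A p b := by
  rw [mem_powTorsion] at hx ⊢
  rw [← Nat.sub_add_cancel h, pow_add, mul_smul, hx, smul_zero]

variable (A p) in
/-- Multiplication by `p ^ (a - 1)`, from the elements killed by `p ^ a` to those killed
by `p`. -/
def socleMap (a : ℕ) : powTorsion A p a →+ AddSubgroup.torsionBy A (p : ℤ) where
  toFun x := ⟨p ^ (a - 1) • (x : A), by
    rw [AddSubgroup.torsionBy.nsmul_iff, smul_smul, ← pow_succ']
    exact mem_powTorsion.1 (mem_powTorsion_of_le (by omega) x.2)⟩
  map_zero' := Subtype.ext (smul_zero _)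
  map_add' x y := Subtype.ext (smul_add _ _ _)

theorem card_ker_socleMap (a : ℕ) :
    Nat.card (socleMap A p a).ker = Nat.card (powTorsion A p (a - 1)) :=
  Nat.card_congr
    { toFun := fun x => ⟨x.1.1, mem_powTorsion.2 (congrArg Subtype.val x.2)⟩
      invFun := fun x => ⟨⟨x.1, mem_powTorsion_of_le (by omega) x.2⟩,
        Subtype.ext (mem_powTorsion.1 x.2)⟩
      left_inv := fun _ => rfl
      right_inv := fun _ => rfl }

/-- Since `p^(a-1) x = p^(b-1) (p^(a-b) x)`, larger exponents give smaller ranges. Listing the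
cyclic factors by decreasing exponent therefore makes the ranges increase, as the count of tuples
requires. -/
theorem range_socleMap_mono {a b : ℕ} (hb : 0 < b) (hab : b ≤ a) :
    (socleMap A p a).range ≤ (socleMap A p b).range := by
  rintro _ ⟨x, rfl⟩
  refine ⟨⟨p ^ (a - b) • (x : A), ?_⟩, Subtype.ext ?_⟩
  · rw [mem_powTorsion, smul_smul, ← pow_add, show b + (a - b) = a by omega]
    exact mem_powTorsion.1 x.2
  · change p ^ (b - 1) • p ^ (a - b) • (x : A) = p ^ (a - 1) • (x : A)
    rw [smul_smul, ← pow_add, show b - 1 + (a - b) = a - 1 by omega]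

end TorsionSubgroups

/-! ### The order of the automorphism group of a product of cyclic groups -/

section Endomorphisms

variable {ι : Type*} [Fintype ι] {p : ℕ} {a : ι → ℕ} {A : Type*} [AddCommGroup A]

/-- The homomorphism from a product of cyclic groups that takes given values on the
generators. -/
def homOfGenerators (g : ∀ i, powTorsion A p (a i)) : (∀ i, ZMod (p ^ a i)) →+ A :=
  ∑ i, (ZMod.lift (p ^ a i) ⟨zmultiplesHom A (g i : A), by
    simp⟩).comp (Pi.evalAddMonoidHom _ i)

theorem homOfGenerators_natCast (g : ∀ i, powTorsion A p (a i)) (m : ι → ℕ) :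
    homOfGenerators g (fun i => (m i : ZMod (p ^ a i))) = ∑ i, m i • (g i : A) := by
  rw [homOfGenerators, AddMonoidHom.finsetSum_apply]
  refine Finset.sum_congr rfl fun i _ => ?_
  simp only [AddMonoidHom.comp_apply, Pi.evalAddMonoidHom_apply]
  refine (congrArg _ (Int.cast_natCast (m i)).symm).trans ((ZMod.lift_coe _ _ _).trans ?_)
  simp

variable (p a A) in
/-- Homomorphisms from a product of cyclic groups correspond to the values on the
generators. -/
def homGeneratorsEquiv [DecidableEq ι] :
    (∀ i, powTorsion A p (a i)) ≃ ((∀ i, ZMod (p ^ a i)) →+ A) where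
  toFun := homOfGenerators
  invFun f i := ⟨f (Pi.single i 1), by
    rw [mem_powTorsion, ← map_nsmul, ← Pi.single_smul, nsmul_eq_mul, mul_one, ZMod.natCast_self,
      Pi.single_zero, map_zero]⟩
  left_inv g := by
    funext i
    refine Subtype.ext ?_
    have h := homOfGenerators_natCast g (Pi.single i 1)
    have e : (fun j => ((Pi.single i 1 : ι → ℕ) j : ZMod (p ^ a j))) = Pi.single i 1 := by
      funext j
      by_cases hj : j = i
      · subst hj; simp
      · simp [Pi.single_eq_of_ne hj]
    rw [e] at h
    change homOfGenerators g (Pi.single i 1) = _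
    rw [h, Finset.sum_eq_single i] <;> simp +contextual [Pi.single_eq_of_ne]
  right_inv f := by
    refine AddMonoidHom.functions_ext _ _ _ fun i y => ?_
    obtain ⟨m, rfl⟩ := ZMod.intCast_surjective y
    have e : ∀ f : (∀ i, ZMod (p ^ a i)) →+ A,
        f (Pi.single i (m : ZMod (p ^ a i))) = m • f (Pi.single i 1) := fun f => by
      rw [← map_zsmul, ← Pi.single_smul, zsmul_eq_mul, mul_one]
    have h := homOfGenerators_natCast (fun i => (⟨f (Pi.single i 1), by
      rw [mem_powTorsion, ← map_nsmul, ← Pi.single_smul, nsmul_eq_mul, mul_one, ZMod.natCast_self,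
        Pi.single_zero, map_zero]⟩ : powTorsion A p (a i))) (Pi.single i 1)
    have e' : (fun j => ((Pi.single i 1 : ι → ℕ) j : ZMod (p ^ a j))) = Pi.single i 1 := by
      funext j
      by_cases hj : j = i
      · subst hj; simp
      · simp [Pi.single_eq_of_ne hj]
    rw [e'] at h
    rw [e, e, h, Finset.sum_eq_single i] <;> simp +contextual [Pi.single_eq_of_ne]

attribute [local instance] AddSubgroup.torsionBy.zmodModule

variable [Fact p.Prime]

theorem sum_smul_socleMap (g : ∀ i, powTorsion A p (a i)) (m : ι → ℕ) :
    ((∑ i, (m i : ZMod p) • socleMap A p (a i) (g i) : AddSubgroup.torsionBy A (p : ℤ)) : A) =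
      homOfGenerators g (fun i => ((p ^ (a i - 1) * m i : ℕ) : ZMod (p ^ a i))) := by
  rw [homOfGenerators_natCast, AddSubgroup.val_finsetSum]
  refine Finset.sum_congr rfl fun i _ => ?_
  rw [Nat.cast_smul_eq_nsmul, mul_comm, mul_smul]
  rfl

theorem natCast_pow_pred_mul_eq_zero_iff {a : ℕ} (ha : 0 < a) (m : ℕ) :
    ((p ^ (a - 1) * m : ℕ) : ZMod (p ^ a)) = 0 ↔ (m : ZMod p) = 0 := by
  obtain ⟨a, rfl⟩ := Nat.exists_eq_add_of_le' ha
  rw [ZMod.natCast_eq_zero_iff, ZMod.natCast_eq_zero_iff, Nat.add_sub_cancel, pow_succ,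
    Nat.mul_dvd_mul_iff_left (pow_pos (Fact.out : p.Prime).pos a)]

theorem exists_natCast_of_smul_eq_zero {a : ℕ} (ha : 0 < a) {y : ZMod (p ^ a)}
    (hy : p • y = 0) : ∃ m : ℕ, y = ((p ^ (a - 1) * m : ℕ) : ZMod (p ^ a)) := by
  obtain ⟨a, rfl⟩ := Nat.exists_eq_add_of_le' ha
  have : NeZero (p ^ (a + 1)) := ⟨pow_ne_zero _ (Fact.out : p.Prime).ne_zero⟩
  obtain ⟨n, rfl⟩ := ZMod.natCast_zmod_surjective y
  rw [← Nat.cast_smul_eq_nsmul (ZMod (p ^ (a + 1))), smul_eq_mul, ← Nat.cast_mul,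
    ZMod.natCast_eq_zero_iff, pow_succ',
    Nat.mul_dvd_mul_iff_left (Fact.out : p.Prime).pos] at hy
  obtain ⟨m, rfl⟩ := hy
  exact ⟨m, rfl⟩

/-- A nonzero kernel contains a nonzero element killed by `p`, found by multiplying by powers of
`p`. The elements killed by `p` have coordinates `p^(a i - 1) * m i`, and on them the homomorphism
is the linear combination of the `socleMap` images with coefficients `m i`. -/
theorem injective_homOfGenerators_iff (ha : ∀ i, 0 < a i) (g : ∀ i, powTorsion A p (a i)) :
    Function.Injective (homOfGenerators g) ↔
      LinearIndependent (ZMod p) fun i => socleMap A p (a i) (g i) := by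
  rw [Fintype.linearIndependent_iff, injective_iff_map_eq_zero]
  constructor
  · intro h c hc i
    have hm := sum_smul_socleMap g fun i => (c i).val
    simp only [ZMod.natCast_zmod_val] at hm
    rw [hc] at hm
    have := congrFun (h _ hm.symm) i
    simpa [natCast_pow_pred_mul_eq_zero_iff (ha i)] using
      (natCast_pow_pred_mul_eq_zero_iff (p := p) (ha i) (c i).val).1 this
  · intro h
    have socle : ∀ y, p • y = 0 → homOfGenerators g y = 0 → y = 0 := by
      intro y hy hgy
      choose m hm using fun i => exists_natCast_of_smul_eq_zero (ha i) (congrFun hy i)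
      obtain rfl := funext hm
      rw [← sum_smul_socleMap] at hgy
      funext i
      exact (natCast_pow_pred_mul_eq_zero_iff (ha i) (m i)).2
        (h (fun i => (m i : ZMod p)) (Subtype.ext hgy) i)
    have iter : ∀ s x, p ^ s • x = 0 → homOfGenerators g x = 0 → x = 0 := by
      intro s
      induction s with
      | zero => intro x hx _; simpa using hx
      | succ s ih =>
        intro x hx hgx
        refine ih x (socle _ ?_ ?_) hgx
        · rwa [smul_smul, ← pow_succ']
        · rw [map_nsmul, hgx, smul_zero]
    intro x hx
    refine iter (∑ i, a i) x ?_ hx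
    funext i
    rw [Pi.smul_apply, nsmul_eq_mul, Pi.zero_apply,
      (ZMod.natCast_eq_zero_iff _ _).2 (pow_dvd_pow p (Finset.single_le_sum
        (fun _ _ => Nat.zero_le _) (Finset.mem_univ i))), zero_mul]

/-- Automorphisms of a finite group are its injective endomorphisms. -/
noncomputable def addAutEquivInjective (A : Type*) [AddCommGroup A] [Finite A] :
    AddAut A ≃ {f : A →+ A // Function.Injective f} where
  toFun e := ⟨e.toAddMonoidHom, e.injective⟩
  invFun f := AddEquiv.ofBijective f.1 (Finite.injective_iff_bijective.1 f.2)
  left_inv e := by ext x; rfl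
  right_inv f := by ext x; rfl

theorem card_injective_homs [DecidableEq ι] (ha : ∀ i, 0 < a i) :
    Nat.card {f : (∀ i, ZMod (p ^ a i)) →+ A // Function.Injective f} =
      Nat.card {g : ∀ i, powTorsion A p (a i) //
        LinearIndependent (ZMod p) fun i => socleMap A p (a i) (g i)} :=
  (Nat.card_congr ((homGeneratorsEquiv p a A).subtypeEquiv fun g =>
    (injective_homOfGenerators_iff ha g).symm)).symm

theorem card_independent_powTorsion [Finite A] {a : ℕ → ℕ} {n : ℕ} (ha : ∀ i < n, 0 < a i)
    (hanti : Antitone a) :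
    Nat.card {g : ∀ i : Fin n, powTorsion A p (a i) //
        LinearIndependent (ZMod p) fun i : Fin n => socleMap A p (a i) (g i)} =
      ∏ i ∈ Finset.range n, (Nat.card (powTorsion A p (a i)) -
        Nat.card (powTorsion A p (a i - 1)) * p ^ i) := by
  rw [card_linearIndependent_tuples (D := fun i => powTorsion A p (a i))
    (fun i => socleMap A p (a i)) n fun i j hij hj => range_socleMap_mono (ha j hj) (hanti hij)]
  exact Finset.prod_congr rfl fun i _ => by rw [card_ker_socleMap]

theorem card_addAut_pi_zmod {a : ℕ → ℕ} {n : ℕ} (ha : ∀ i < n, 0 < a i) (hanti : Antitone a) :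
    Nat.card (AddAut (∀ i : Fin n, ZMod (p ^ a i))) = ∏ i ∈ Finset.range n,
      (Nat.card (powTorsion (∀ i : Fin n, ZMod (p ^ a i)) p (a i)) -
        Nat.card (powTorsion (∀ i : Fin n, ZMod (p ^ a i)) p (a i - 1)) * p ^ i) := by
  have : ∀ i : Fin n, NeZero (p ^ a i) := fun i => ⟨pow_ne_zero _ (Fact.out : p.Prime).ne_zero⟩
  rw [← card_independent_powTorsion ha hanti, Nat.card_congr (addAutEquivInjective _)]
  exact card_injective_homs fun i => ha i i.2

theorem card_powTorsion_zmod (a m : ℕ) :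
    Nat.card (powTorsion (ZMod (p ^ a)) p m) = p ^ min a m := by
  have hp : 0 < p ^ a := pow_pos (Fact.out : p.Prime).pos a
  have : NeZero (p ^ a) := ⟨hp.ne'⟩
  have h := IsAddCyclic.card_nsmulAddMonoidHom_ker (ZMod (p ^ a)) (p ^ m)
  rw [Nat.card_zmod] at h
  have hgcd : (p ^ a).gcd (p ^ m) = p ^ min a m := by
    rcases le_total a m with hle | hle
    · rw [min_eq_left hle, Nat.gcd_eq_left (pow_dvd_pow p hle)]
    · rw [min_eq_right hle, Nat.gcd_eq_right (pow_dvd_pow p hle)]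
  rw [← hgcd, ← h]
  exact Nat.card_congr (Equiv.subtypeEquivRight fun x => mem_powTorsion)

theorem card_powTorsion_pi (a : ι → ℕ) (m : ℕ) :
    Nat.card (powTorsion (∀ i, ZMod (p ^ a i)) p m) = p ^ ∑ i, min (a i) m := by
  rw [← Finset.prod_pow_eq_pow_sum, ← Finset.prod_congr rfl fun i _ => card_powTorsion_zmod _ _,
    ← Nat.card_pi]
  exact Nat.card_congr
    { toFun := fun x i => ⟨x.1 i, mem_powTorsion.2 (congrFun (mem_powTorsion.1 x.2) i)⟩
      invFun := fun x => ⟨fun i => x i, mem_powTorsion.2 (funext fun i => mem_powTorsion.1 (x i).2)⟩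
      left_inv := fun _ => rfl
      right_inv := fun _ => rfl }

end Endomorphisms

/-! ### The order of the automorphism group in terms of the dual partition -/

section DualPartition

variable {r : ℕ} {k : Fin r → ℕ}

theorem dualPart_antitone (k : Fin r → ℕ) : Antitone (dualPart k) := fun _ _ h =>
  Finset.card_le_card (Finset.monotone_filter_right _ fun _ _ hj => h.trans_lt hj)

theorem dualPart_le (k : Fin r → ℕ) (m : ℕ) : dualPart k m ≤ r :=
  (Finset.card_filter_le _ _).trans (by simp)

theorem lt_dualPart_iff (hk : Antitone k) {j : Fin r} {m : ℕ} :
    (j : ℕ) < dualPart k m ↔ m < k j := by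
  constructor
  · intro h
    by_contra hm
    have : Finset.univ.filter (fun i => m < k i) ⊆ Finset.Iio j := fun i hi => by
      rw [Finset.mem_Iio]
      by_contra hij
      exact hm ((Finset.mem_filter.1 hi).2.trans_le (hk (not_lt.1 hij)))
    have := Finset.card_le_card this
    rw [Fin.card_Iio] at this
    exact absurd h (not_lt.2 this)
  · intro h
    have : Finset.Iic j ⊆ Finset.univ.filter (fun i => m < k i) := fun i hi =>
      Finset.mem_filter.2 ⟨Finset.mem_univ _, h.trans_le (hk (Finset.mem_Iic.1 hi))⟩
    have := Finset.card_le_card this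
    rwa [Fin.card_Iic] at this

theorem le_sup_parts (k : Fin r → ℕ) (j : Fin r) : k j ≤ Finset.univ.sup k :=
  Finset.le_sup (Finset.mem_univ j)

theorem dualPart_pos {m : ℕ} (h : m < Finset.univ.sup k) : 0 < dualPart k m := by
  obtain ⟨j, _, hj⟩ := Finset.lt_sup_iff.1 h
  exact Finset.card_pos.2 ⟨j, Finset.mem_filter.2 ⟨Finset.mem_univ _, hj⟩⟩

/-- The sum of the first `m` parts. -/
def partialSum (k : Fin r → ℕ) (m : ℕ) : ℕ := ∑ j : Fin r, if (j : ℕ) < m then k j else 0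

theorem partialSum_succ (k : Fin r → ℕ) (j : Fin r) :
    partialSum k (j + 1) = partialSum k j + k j := by
  rw [partialSum, partialSum, ← Fintype.sum_ite_eq' j k, ← Finset.sum_add_distrib]
  refine Finset.sum_congr rfl fun i _ => ?_
  rcases lt_trichotomy i j with h | rfl | h
  · have h' : (i : ℕ) < j := h
    simp [h.ne, h', Nat.lt_succ_of_lt h']
  · simp
  · have h' : (j : ℕ) < i := h
    simp [h.ne', not_lt.2 h'.le, show ¬ (i : ℕ) < j + 1 by omega]

theorem partialSum_self (k : Fin r → ℕ) : partialSum k r = ∑ j, k j :=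
  Finset.sum_congr rfl fun j _ => if_pos j.2

theorem sum_range_ite_lt {n c : ℕ} (h : c ≤ n) (d : ℕ) :
    ∑ i ∈ Finset.range n, (if i < c then d else 0) = c * d := by
  rw [← Finset.sum_filter, Finset.sum_const, smul_eq_mul]
  congr 1
  rw [show Finset.filter (fun i => i < c) (Finset.range n) = Finset.range c by
    ext i; simp only [Finset.mem_filter, Finset.mem_range]; omega, Finset.card_range]

/-- Double counting in the Young diagram: both sides count the cells that belong to the first `m`
parts of `k`. -/
theorem sum_min_dualPart (hk : Antitone k) (m : ℕ) :
    ∑ i : Fin (Finset.univ.sup k), min (dualPart k i) m = partialSum k m := by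
  rw [Fin.sum_univ_eq_sum_range (fun i => min (dualPart k i) m)]
  have hmin : ∀ i, min (dualPart k i) m =
      ∑ j : Fin r, if (j : ℕ) < m then (if i < k j then 1 else 0) else 0 := by
    intro i
    have hle := dualPart_le k i
    simp only [← lt_dualPart_iff hk]
    rw [Fin.sum_univ_eq_sum_range
      (fun j => if j < m then (if j < dualPart k i then 1 else 0) else 0)]
    have : ∀ j, (if j < m then (if j < dualPart k i then 1 else 0) else 0) =
        if j < min (dualPart k i) m then 1 else 0 := fun j => by
      simp only [lt_min_iff, ← ite_and, and_comm]
    rw [Finset.sum_congr rfl fun j _ => this j,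
      sum_range_ite_lt ((min_le_left _ _).trans hle), mul_one]
  rw [Finset.sum_congr rfl fun i _ => hmin i, Finset.sum_comm, partialSum]
  refine Finset.sum_congr rfl fun j _ => ?_
  split_ifs
  · rw [sum_range_ite_lt (le_sup_parts k j), mul_one]
  · simp

/-- The part `k j` enters the partial sum exactly for the `k j` indices `i < k j`, and so
contributes its square. -/
theorem sum_partialSum_dualPart (hk : Antitone k) :
    ∑ i ∈ Finset.range (Finset.univ.sup k), partialSum k (dualPart k i) = ∑ j, k j ^ 2 := by
  simp only [partialSum, lt_dualPart_iff hk]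
  rw [Finset.sum_comm]
  refine Finset.sum_congr rfl fun j _ => ?_
  rw [sum_range_ite_lt (le_sup_parts k j), sq]

theorem dualPart_eq_succ_iff (hk : Antitone k) {i : ℕ} {j : Fin r} :
    dualPart k i = j + 1 ↔ nextPart k j ≤ i ∧ i < k j := by
  rw [← lt_dualPart_iff hk, nextPart]
  split_ifs with h
  · have := lt_dualPart_iff hk (j := ⟨j + 1, h⟩) (m := i)
    simp only at this
    rw [← not_lt, ← this]
    omega
  · have := dualPart_le k i
    omega

theorem exists_dualPart_eq_succ {i : ℕ} (hi : i < Finset.univ.sup k) :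
    ∃ j : Fin r, dualPart k i = j + 1 := by
  have h1 := dualPart_pos hi
  have h2 := dualPart_le k i
  exact ⟨⟨dualPart k i - 1, by omega⟩, by simp only; omega⟩

theorem prod_Ico_one_sub_pow (x : ℝ) {a b : ℕ} :
    ∏ i ∈ Finset.Ico a b, (1 - x ^ (b - i)) = eulerPoly (b - a) x := by
  rw [Finset.prod_Ico_eq_prod_range, eulerPoly_eq_prod_range,
    ← Finset.prod_range_reflect (fun m => 1 - x ^ (m + 1))]
  refine Finset.prod_congr rfl fun i hi => ?_
  have := Finset.mem_range.1 hi
  congr 2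
  omega

theorem prod_eulerPoly_eq (hk : Antitone k) (x : ℝ) :
    ∏ j, eulerPoly (k j - nextPart k j) x = ∏ i ∈ Finset.range (Finset.univ.sup k),
      ∏ j ∈ Finset.univ.filter (fun j : Fin r => dualPart k i = j + 1), (1 - x ^ (k j - i)) := by
  simp only [← prod_Ico_one_sub_pow]
  refine Finset.prod_comm' fun j i => ?_
  simp only [Finset.mem_univ, true_and, Finset.mem_Ico, Finset.mem_filter, Finset.mem_range,
    dualPart_eq_succ_iff hk, iff_self_and]
  exact fun h => h.2.trans_le (le_sup_parts k j)

variable (p : ℕ) [Fact p.Prime]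

theorem card_powTorsion_dual (hk : Antitone k) (m : ℕ) :
    Nat.card (powTorsion (∀ i : Fin (Finset.univ.sup k), ZMod (p ^ dualPart k i)) p m) =
      p ^ partialSum k m := by
  rw [card_powTorsion_pi, sum_min_dualPart hk]

theorem cardAut_dualClass_eq (hk : Antitone k) :
    (dualClass p k).cardAut = ∏ i ∈ Finset.range (Finset.univ.sup k),
      (p ^ partialSum k (dualPart k i) - p ^ partialSum k (dualPart k i - 1) * p ^ i) := by
  change Nat.card (MulAut (∀ i : Fin (Finset.univ.sup k),
    Multiplicative (ZMod (p ^ dualPart k i)))) = _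
  have e := (MulAut.congr (MulEquiv.piMultiplicative
    fun i : Fin (Finset.univ.sup k) => ZMod (p ^ dualPart k i))).toEquiv.symm.trans
      ((MulAutMultiplicative _).toEquiv.trans Multiplicative.toAdd)
  rw [Nat.card_congr e, card_addAut_pi_zmod (fun i hi => dualPart_pos hi) (dualPart_antitone k)]
  simp only [card_powTorsion_dual p hk]

theorem prime_one_div_pos : (0 : ℝ) < 1 / p :=
  one_div_pos.2 (Nat.cast_pos.2 (Fact.out : p.Prime).pos)

theorem prime_one_div_lt_one : (1 : ℝ) / p < 1 := by
  rw [div_lt_one (Nat.cast_pos.2 (Fact.out : p.Prime).pos)]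
  exact_mod_cast (Fact.out : p.Prime).one_lt

/-- If the cyclic factor `i` has order `p^(j+1)`, its factor in `|Aut|` is `p^(k_0 + ... + k_j) (1 -
x^(k_j - i))`, parts being numbered from `0`. The powers of `p` multiply to `p^(∑ k_j^2)`. For fixed
`j` the index `i` runs from the next part up to `k_j - 1`, which yields `f_{k_j - k_{j+1}}`. -/
theorem one_div_cardAut_dualClass (hk : Antitone k) :
    1 / ((dualClass p k).cardAut : ℝ) =
      (1 / p : ℝ) ^ (∑ j, k j ^ 2) / ∏ j, eulerPoly (k j - nextPart k j) (1 / p) := by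
  have hp : (p : ℝ) ≠ 0 := Nat.cast_ne_zero.2 (Fact.out : p.Prime).ne_zero
  have hfac : ∀ i ∈ Finset.range (Finset.univ.sup k),
      ((p ^ partialSum k (dualPart k i) - p ^ partialSum k (dualPart k i - 1) * p ^ i : ℕ) : ℝ) =
      (p : ℝ) ^ partialSum k (dualPart k i) *
        ∏ j ∈ Finset.univ.filter (fun j : Fin r => dualPart k i = j + 1),
          (1 - (1 / p : ℝ) ^ (k j - i)) := by
    intro i hi
    obtain ⟨j, hj⟩ := exists_dualPart_eq_succ (Finset.mem_range.1 hi)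
    have hij := ((dualPart_eq_succ_iff hk).1 hj).2
    have hfil : Finset.univ.filter (fun j : Fin r => dualPart k i = j + 1) = {j} := by
      ext j'
      simp only [Finset.mem_filter, Finset.mem_univ, true_and, Finset.mem_singleton, hj]
      rw [Fin.ext_iff]
      omega
    rw [hfil, Finset.prod_singleton, hj, Nat.add_sub_cancel, partialSum_succ, ← pow_add,
      Nat.cast_sub (Nat.pow_le_pow_right (Fact.out : p.Prime).pos (by omega))]
    push_cast
    obtain ⟨d, hd⟩ := Nat.exists_eq_add_of_lt hij
    rw [hd, show i + d + 1 - i = d + 1 by omega]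
    simp only [one_div, inv_pow, pow_add, pow_one]
    field_simp
  rw [cardAut_dualClass_eq p hk, Nat.cast_prod, Finset.prod_congr rfl hfac,
    Finset.prod_mul_distrib, ← prod_eulerPoly_eq hk, Finset.prod_pow_eq_pow_sum,
    sum_partialSum_dualPart hk, one_div_pow, div_div]

theorem card_dualClass (hk : Antitone k) : (dualClass p k).card = p ^ ∑ j, k j := by
  change Nat.card (∀ i : Fin (Finset.univ.sup k), Multiplicative (ZMod (p ^ dualPart k i))) = _
  rw [Nat.card_pi, ← partialSum_self, ← sum_min_dualPart hk, ← Finset.prod_pow_eq_pow_sum]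
  refine Finset.prod_congr rfl fun i _ => ?_
  rw [min_eq_left (dualPart_le k i)]
  exact Nat.card_zmod _

theorem AbPClass.cardHol_eq {p : ℕ} (c : AbPClass p) : c.cardHol = c.card * c.cardAut := by
  induction c using Quotient.inductionOn with
  | h G => exact card_holomorph G.carrier

theorem agTerm_eq_one_div_cardAut (hk : Antitone k) :
    agTerm r (r + 1) (1 / p) k = 1 / ((dualClass p k).cardAut : ℝ) := by
  rw [one_div_cardAut_dualClass p hk, show r + 1 = chainResidue 0 r from rfl,
    agTerm_chainResidue _ zero_le_one, chainTerm]
  simp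

theorem agTerm_eq_one_div_cardHol (hk : Antitone k) :
    agTerm r 1 (1 / p) k = 1 / ((dualClass p k).cardHol : ℝ) := by
  rw [AbPClass.cardHol_eq, Nat.cast_mul, ← one_div_mul_one_div, one_div_cardAut_dualClass p hk,
    show (1 : ℕ) = chainResidue 1 r from rfl, agTerm_chainResidue _ le_rfl, chainTerm,
    card_dualClass p hk, Finset.sum_add_distrib, pow_add]
  push_cast
  simp only [one_mul, one_div_pow]
  ring

end DualPartition

/-! ### Classification by sequences of bounded length -/

section Classification

variable {r : ℕ} {p : ℕ}

/-- Additive isomorphisms between products of cyclic groups, written multiplicatively. -/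
def piMultiplicativeCongr {ι κ : Type*} {A : ι → Type*} {B : κ → Type*} [∀ i, AddGroup (A i)]
    [∀ i, AddGroup (B i)] :
    ((∀ i, A i) ≃+ (∀ i, B i)) ≃
      ((∀ i, Multiplicative (A i)) ≃* (∀ i, Multiplicative (B i))) where
  toFun e := (MulEquiv.piMultiplicative A).symm.trans
    ((AddEquiv.toMultiplicative e).trans (MulEquiv.piMultiplicative B))
  invFun e := AddEquiv.toMultiplicative.symm ((MulEquiv.piMultiplicative A).trans
    (e.trans (MulEquiv.piMultiplicative B).symm))
  left_inv _ := rfl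
  right_inv _ := rfl

theorem card_powTorsion_congr {A B : Type*} [AddCommGroup A] [AddCommGroup B] (e : A ≃+ B)
    (m : ℕ) : Nat.card (powTorsion A p m) = Nat.card (powTorsion B p m) :=
  Nat.card_congr (e.toEquiv.subtypeEquiv fun x => by
    rw [mem_powTorsion, mem_powTorsion, ← e.map_eq_zero_iff, map_nsmul]; rfl)

variable [Fact p.Prime]

/-- The number of elements killed by `p^m` is an isomorphism invariant, and it determines the
partial sums of `k`. -/
theorem eq_of_dualClass_eq {k l : Fin r → ℕ} (hk : Antitone k) (hl : Antitone l)
    (h : dualClass p k = dualClass p l) : k = l := by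
  obtain ⟨e⟩ : Nonempty ((dualGroup p k).carrier ≃* (dualGroup p l).carrier) := Quotient.exact h
  have hsum : ∀ m, partialSum k m = partialSum l m := fun m => by
    have := card_powTorsion_congr (p := p) (piMultiplicativeCongr.symm e) m
    rw [card_powTorsion_dual p hk, card_powTorsion_dual p hl] at this
    exact Nat.pow_right_injective (Fact.out : p.Prime).two_le this
  funext j
  have h1 := hsum (j + 1)
  rw [partialSum_succ, partialSum_succ, hsum j] at h1
  exact Nat.add_left_cancel h1

theorem exponent_dualClass_le (k : Fin r → ℕ) : (dualClass p k).exponent ≤ p ^ r := by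
  have hp : 0 < p ^ r := pow_pos (Fact.out : p.Prime).pos r
  refine Nat.le_of_dvd hp (Monoid.exponent_dvd_of_forall_pow_eq_one fun g => ?_)
  funext i
  change p ^ r • (show ZMod (p ^ dualPart k i) from g i) = 0
  rw [nsmul_eq_mul, (ZMod.natCast_eq_zero_iff _ _).2 (pow_dvd_pow p (dualPart_le k i)), zero_mul]

/-- The dual of the dual of a partition with parts at most `r` is the partition. -/
theorem dualPart_dualPart {n : ℕ} {b : Fin n → ℕ} (hb : Antitone b) (hbr : ∀ i, b i ≤ r)
    (i : Fin n) : dualPart (fun j : Fin r => dualPart b j) i = b i := by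
  -- Only the outer `dualPart` is unfolded; the inner one is needed intact for `lt_dualPart_iff`.
  simp only [dualPart.eq_1 (fun j : Fin r => dualPart b j), lt_dualPart_iff hb]
  rw [show (Finset.univ.filter fun j : Fin r => (j : ℕ) < b i) =
    Finset.univ.filter fun j : Fin r => (j : ℕ) < b i from rfl, Fin.card_filter_val_lt,
    min_eq_right (hbr i)]

theorem sup_dualPart {n : ℕ} {b : Fin n → ℕ} (hb1 : ∀ i, 0 < b i) (hbr : ∀ i, b i ≤ r) :
    Finset.univ.sup (fun j : Fin r => dualPart b j) = n := by
  refine le_antisymm (Finset.sup_le fun j _ => dualPart_le b j) ?_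
  rcases Nat.eq_zero_or_pos n with rfl | hn
  · exact Nat.zero_le _
  · have hr : 0 < r := (hb1 ⟨0, hn⟩).trans_le (hbr _)
    have h0 : dualPart b 0 = n := by
      rw [dualPart, Finset.filter_true_of_mem fun i _ => hb1 i, Finset.card_univ, Fintype.card_fin]
    calc n = dualPart b ((⟨0, hr⟩ : Fin r) : ℕ) := h0.symm
      _ ≤ _ := le_sup_parts (fun j : Fin r => dualPart b j) ⟨0, hr⟩

theorem exists_equiv_antitone {ι : Type*} [Fintype ι] (b : ι → ℕ) :
    ∃ σ : Fin (Fintype.card ι) ≃ ι, Antitone (b ∘ σ) := by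
  let f : Fin (Fintype.card ι) → ℕᵒᵈ := fun i => OrderDual.toDual (b ((Fintype.equivFin ι).symm i))
  exact ⟨(Tuple.sort f).trans (Fintype.equivFin ι).symm, fun i j hij => Tuple.monotone_sort f hij⟩

/-- The structure theorem gives cyclic factors; their orders are `p^b` with `0 < b ≤ r`. Sorting the
exponents decreasingly and dualizing gives `k`, whose own dual returns the exponents. -/
theorem exists_dualClass_eq (c : AbPClass p) (hc : c.exponent ≤ p ^ r) :
    ∃ k : Fin r → ℕ, Antitone k ∧ dualClass p k = c := by
  induction c using Quotient.inductionOn with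
  | h G =>
    have hp : p.Prime := Fact.out
    change Monoid.exponent G.carrier ≤ p ^ r at hc
    obtain ⟨ι, _, n, hn, ⟨e⟩⟩ := CommGroup.equiv_prod_multiplicative_zmod_of_finite G.carrier
    classical
    have hb : ∀ i, ∃ b, n i = p ^ b ∧ 0 < b ∧ b ≤ r := by
      intro i
      -- A generator of the factor `i` transfers its order `n i` to `G`, where the `p`-group
      -- property and the bound on the exponent apply.
      set g : ∀ i, Multiplicative (ZMod (n i)) := Pi.mulSingle i (Multiplicative.ofAdd 1) with hg
      have hord : orderOf (e.symm g) = n i := by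
        rw [MulEquiv.orderOf_eq, hg, ← MonoidHom.mulSingle_apply,
          orderOf_injective _ fun a b h => by simpa using congrFun h i, orderOf_ofAdd_eq_addOrderOf,
          ZMod.addOrderOf_one]
      obtain ⟨b, hb⟩ := IsPGroup.iff_orderOf.1 G.isPGroup (e.symm g)
      rw [hord] at hb
      have h1 := hn i
      have hle : p ^ b ≤ p ^ r := by
        rw [← hb, ← hord]
        exact (Nat.le_of_dvd (Nat.pos_of_ne_zero Monoid.exponent_ne_zero_of_finite)
          (Monoid.order_dvd_exponent _)).trans hc
      refine ⟨b, hb, Nat.pos_of_ne_zero fun h => ?_, (Nat.pow_le_pow_iff_right hp.one_lt).1 hle⟩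
      rw [hb, h, pow_zero] at h1
      exact lt_irrefl _ h1
    choose b hnb hb1 hbr using hb
    obtain ⟨σ, hσ⟩ := exists_equiv_antitone b
    set k : Fin r → ℕ := fun j => dualPart (b ∘ σ) j
    have hk : Antitone k := fun i j hij => dualPart_antitone (b ∘ σ) hij
    have hsup : Finset.univ.sup k = Fintype.card ι :=
      sup_dualPart (fun i => hb1 (σ i)) fun i => hbr (σ i)
    set τ : Fin (Finset.univ.sup k) ≃ ι := (finCongr hsup).trans σ
    have hτ : ∀ m : Fin (Finset.univ.sup k), p ^ dualPart k m = n (τ m) := fun m => by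
      rw [hnb]
      exact congrArg (p ^ ·) (dualPart_dualPart hσ (fun i => hbr (σ i)) (finCongr hsup m))
    have f : (∀ m : Fin (Finset.univ.sup k), ZMod (p ^ dualPart k m)) ≃+ ∀ i, ZMod (n i) :=
      (AddEquiv.piCongrRight fun m => (ZMod.ringEquivCongr (hτ m)).toAddEquiv).trans
        (RingEquiv.piCongrLeft (fun i => ZMod (n i)) τ).toAddEquiv
    exact ⟨k, hk, Quotient.sound ⟨(piMultiplicativeCongr f).trans e.symm⟩⟩

theorem bijOn_dualClass (p : ℕ) [Fact p.Prime] (r : ℕ) :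
    Set.BijOn (fun k : Fin r → ℕ => dualClass p k) {k | Antitone k} {c | c.exponent ≤ p ^ r} :=
  ⟨fun k _ => exponent_dualClass_le k, fun _ hk _ hl h => eq_of_dualClass_eq hk hl h,
    fun c hc => exists_dualClass_eq c hc⟩

/-- The groups of exponent at most `p ^ r`, indexed by decreasing sequences. -/
noncomputable def dualClassEquiv (p : ℕ) [Fact p.Prime] (r : ℕ) :
    AGIndex r ≃ {c : AbPClass p // c.exponent ≤ p ^ r} :=
  (bijOn_dualClass p r).equiv _

theorem dualClassEquiv_apply (r : ℕ) (k : AGIndex r) :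
    (dualClassEquiv p r k : AbPClass p) = dualClass p k.1 := rfl

end Classification

/-! ### Sums of nonnegative terms over exhausting sets -/

section Exhaustion

/-- Every finite set eventually lies in `S r`, so finite sums are at most `L`. Conversely each `a r`
is at most the total sum. The sets need not increase. -/
theorem hasSum_of_exhaustion {α : Type*} {f : α → ℝ} (hf : ∀ c, 0 ≤ f c) {S : ℕ → Set α}
    (hS : ∀ c, ∀ᶠ r in atTop, c ∈ S r) {a : ℕ → ℝ} {L : ℝ}
    (ha : ∀ᶠ r in atTop, HasSum (fun c : S r => f c) (a r)) (hL : Tendsto a atTop (𝓝 L)) :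
    HasSum f L := by
  have hle : ∀ F : Finset α, ∑ c ∈ F, f c ≤ L := fun F => by
    refine ge_of_tendsto hL ?_
    filter_upwards [ha, (F.eventually_all).2 fun c _ => hS c] with r hr hF
    have h := hasSum_subtype_iff_indicator.1 hr
    rw [← Finset.sum_congr rfl fun c hc => Set.indicator_of_mem (hF c hc) f]
    exact sum_le_hasSum F (fun c _ => Set.indicator_nonneg (fun c _ => hf c) c) h
  have hs := summable_of_sum_le hf hle
  rw [hs.hasSum_iff]
  refine le_antisymm (hs.tsum_le_of_sum_le hle) (le_of_tendsto hL ?_)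
  filter_upwards [ha] with r hr
  exact hasSum_le (Set.indicator_le_self' fun c _ => hf c)
    (hasSum_subtype_iff_indicator.1 hr) hs.hasSum

end Exhaustion

/-! ### Generating functions of partitions -/

section Partitions

variable {x : ℝ}

theorem one_div_eulerPoly_succ (n : ℕ) (x : ℝ) :
    1 / eulerPoly (n + 1) x = (1 - x ^ (n + 1))⁻¹ * (1 / eulerPoly n x) := by
  rw [eulerPoly_succ, one_div, mul_inv, mul_comm, one_div]

theorem hasSum_geometric_mul (h0 : 0 ≤ x) (h1 : x < 1) (r : ℕ) {γ : Type*} {g : γ → ℝ} {b : ℝ}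
    (hg : ∀ c, 0 ≤ g c) (h : HasSum g b) :
    HasSum (fun q : ℕ × γ => (x ^ (r + 1)) ^ q.1 * g q.2) ((1 - x ^ (r + 1))⁻¹ * b) :=
  hasSum_prod_of_nonneg (fun _ => mul_nonneg (pow_nonneg (pow_nonneg h0 _) _) (hg _))
    (fun n => h.mul_left ((x ^ (r + 1)) ^ n))
    ((hasSum_geometric_of_lt_one (pow_nonneg h0 _) (pow_lt_one₀ h0 h1 r.succ_ne_zero)).mul_right b)

/-- A decreasing sequence is determined by its last part and its differences with it. -/
def antitoneSnocEquiv (r : ℕ) : AGIndex (r + 1) ≃ ℕ × AGIndex r where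
  toFun k := (k.1 (Fin.last r), ⟨fun j => k.1 j.castSucc - k.1 (Fin.last r), fun _ _ h =>
    Nat.sub_le_sub_right (k.2 (Fin.castSucc_le_castSucc_iff.2 h)) _⟩)
  invFun q := ⟨Fin.snoc (α := fun _ => ℕ) (fun j => q.2.1 j + q.1) q.1, fun i j h => by
    induction j using Fin.lastCases with
    | last =>
      induction i using Fin.lastCases with
      | last => rfl
      | cast i => simp
    | cast j =>
      induction i using Fin.lastCases with
      | last => exact absurd h (not_le.2 (Fin.castSucc_lt_last j))
      | cast i => simpa using q.2.2 (Fin.castSucc_le_castSucc_iff.1 h)⟩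
  left_inv k := by
    refine Subtype.ext (funext fun j => ?_)
    induction j using Fin.lastCases with
    | last => simp
    | cast j => simpa using Nat.sub_add_cancel (k.2 (Fin.le_last j.castSucc))
  right_inv q := by
    refine Prod.ext ?_ (Subtype.ext (funext fun j => ?_)) <;> simp

/-- Subtracting the last part from all `r + 1` parts leaves a sequence of length `r` and splits off
a geometric series in `x^(r+1)`. At `x = 1/p` this sums `1/|G|` over exponent at most `p^r`. -/
theorem hasSum_pow_sum_antitone (h0 : 0 ≤ x) (h1 : x < 1) (r : ℕ) :
    HasSum (fun k : AGIndex r => x ^ ∑ j, k.1 j) (1 / eulerPoly r x) := by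
  induction r with
  | zero =>
    have : Unique (AGIndex 0) := ⟨⟨⟨Fin.elim0, Subsingleton.antitone _⟩⟩,
      fun _ => Subtype.ext (Subsingleton.elim _ _)⟩
    convert hasSum_fintype (fun k : AGIndex 0 => x ^ ∑ j, k.1 j) using 1
    simp
  | succ r ih =>
    rw [← (antitoneSnocEquiv r).symm.hasSum_iff, one_div_eulerPoly_succ]
    convert hasSum_geometric_mul h0 h1 r (g := fun k : AGIndex r => x ^ ∑ j, k.1 j)
      (fun _ => pow_nonneg h0 _) ih using 1
    funext q
    simp only [Function.comp_apply, antitoneSnocEquiv, Equiv.coe_fn_symm_mk]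
    rw [← pow_mul, ← pow_add, Fin.sum_univ_castSucc]
    simp only [Fin.snoc_castSucc, Fin.snoc_last, Finset.sum_add_distrib, Finset.sum_const,
      Finset.card_univ, Fintype.card_fin, smul_eq_mul]
    congr 1
    ring

/-- The count by bounded part size instead of bounded length: `d j` is the multiplicity of the part
`j + 1`. -/
theorem hasSum_pow_multiplicities (h0 : 0 ≤ x) (h1 : x < 1) (r : ℕ) :
    HasSum (fun d : Fin r → ℕ => x ^ ∑ j : Fin r, ((j : ℕ) + 1) * d j) (1 / eulerPoly r x) := by
  induction r with
  | zero =>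
    convert hasSum_fintype (fun d : Fin 0 → ℕ => x ^ ∑ j : Fin 0, ((j : ℕ) + 1) * d j) using 1
    simp
  | succ r ih =>
    rw [← (Fin.snocEquiv fun _ => ℕ).hasSum_iff, one_div_eulerPoly_succ]
    convert hasSum_geometric_mul h0 h1 r
      (g := fun d : Fin r → ℕ => x ^ ∑ j : Fin r, ((j : ℕ) + 1) * d j)
      (fun _ => pow_nonneg h0 _) ih using 1
    funext q
    simp only [Function.comp_apply, Fin.snocEquiv]
    rw [← pow_mul, ← pow_add, Fin.sum_univ_castSucc]
    simp [add_comm]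

/-- Partitions of all numbers, as multisets of positive numbers. -/
def sigmaPartitionEquiv : (Σ n, Nat.Partition n) ≃ {s : Multiset ℕ // ∀ i ∈ s, 0 < i} where
  toFun q := ⟨q.2.parts, fun _ hi => q.2.parts_pos hi⟩
  invFun s := ⟨s.1.sum, ⟨s.1, fun {i} hi => s.2 i hi, rfl⟩⟩
  left_inv q := by
    obtain ⟨n, ⟨s, hs, rfl⟩⟩ := q
    rfl
  right_inv _ := rfl

/-- Multisets of positive numbers that are at most `r`, by multiplicities. -/
def multiplicityEquiv (r : ℕ) :
    (Fin r → ℕ) ≃ {s : {s : Multiset ℕ // ∀ i ∈ s, 0 < i} // ∀ i ∈ s.1, i ≤ r} where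
  toFun d := ⟨⟨∑ j : Fin r, Multiset.replicate (d j) ((j : ℕ) + 1), fun i hi => by
      obtain ⟨j, _, hj⟩ := Multiset.mem_sum.1 hi
      rw [Multiset.eq_of_mem_replicate hj]
      omega⟩, fun i hi => by
      obtain ⟨j, _, hj⟩ := Multiset.mem_sum.1
        (show i ∈ ∑ j : Fin r, Multiset.replicate (d j) ((j : ℕ) + 1) from hi)
      rw [Multiset.eq_of_mem_replicate hj]
      omega⟩
  invFun s j := s.1.1.count ((j : ℕ) + 1)
  left_inv d := by
    funext j
    simp only [Multiset.count_sum', Multiset.count_replicate]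
    rw [Finset.sum_eq_single j] <;> simp +contextual [Fin.ext_iff]
  right_inv s := by
    refine Subtype.ext (Subtype.ext (Multiset.ext.2 fun i => ?_))
    simp only [Multiset.count_sum', Multiset.count_replicate]
    by_cases hi : i ∈ s.1.1
    · have h1 := s.1.2 i hi
      have h2 := s.2 i hi
      rw [Finset.sum_eq_single (⟨i - 1, by omega⟩ : Fin r)]
      · rw [if_pos (by simp only; omega)]
        congr 1
        simp only
        omega
      · intro j _ hj
        rw [if_neg]
        intro h
        exact hj (Fin.ext (by simp only; omega))
      · simp
    · rw [Multiset.count_eq_zero_of_notMem hi]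
      refine Finset.sum_eq_zero fun j _ => ?_
      split_ifs with h
      · rw [h]; exact Multiset.count_eq_zero_of_notMem hi
      · rfl

theorem hasSum_pow_multiset_sum (h0 : 0 ≤ x) (h1 : x < 1) :
    HasSum (fun s : {s : Multiset ℕ // ∀ i ∈ s, 0 < i} => x ^ s.1.sum) (1 / eulerInf x) := by
  refine hasSum_of_exhaustion (fun _ => pow_nonneg h0 _) (S := fun r => {s | ∀ i ∈ s.1, i ≤ r})
    (fun s => ?_) (a := fun r => 1 / eulerPoly r x) (Eventually.of_forall fun r => ?_)
    (tendsto_const_nhds.div (tendsto_eulerPoly h0 h1) (eulerInf_pos h0 h1).ne')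
  · filter_upwards [eventually_ge_atTop s.1.sum] with r hr i hi
    exact (Multiset.le_sum_of_mem hi).trans hr
  · refine (multiplicityEquiv r).hasSum_iff.1 ?_
    convert hasSum_pow_multiplicities h0 h1 r using 1
    funext d
    simp only [Function.comp_apply, multiplicityEquiv, Equiv.coe_fn_mk]
    congr 1
    rw [Multiset.sum_sum]
    refine Finset.sum_congr rfl fun j _ => ?_
    rw [Multiset.sum_replicate, smul_eq_mul, mul_comm]

/-- Euler's generating function for the number of partitions. -/
theorem hasSum_card_partition (h0 : 0 ≤ x) (h1 : x < 1) :
    HasSum (fun n : ℕ => (Fintype.card (Nat.Partition n) : ℝ) * x ^ n) (1 / eulerInf x) := by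
  refine (sigmaPartitionEquiv.hasSum_iff.2 (hasSum_pow_multiset_sum h0 h1)).sigma fun n => ?_
  convert hasSum_fintype _ using 1
  rw [← nsmul_eq_mul, ← Finset.card_univ, ← Finset.sum_const]
  refine Finset.sum_congr rfl fun q _ => ?_
  simp [sigmaPartitionEquiv, q.parts_sum]

end Partitions


/-! ### Passage to the limit over all groups -/

section Limits

variable {x : ℝ}

theorem hasProd_geomFactor_ge (h0 : 0 ≤ x) (h1 : x < 1) {a : ℕ} (ha : 1 ≤ a) :
    HasProd (fun j : {j : ℕ // a ≤ j} => geomFactor x j) (1 / ∏' n : ℕ, (1 - x ^ (n + a))) := by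
  let e : ℕ ≃ {j : ℕ // a ≤ j} :=
    { toFun := fun n => ⟨n + a, Nat.le_add_left a n⟩
      invFun := fun j => j - a
      left_inv := fun n => Nat.add_sub_cancel n a
      right_inv := fun j => Subtype.ext (Nat.sub_add_cancel j.2) }
  rw [← e.hasProd_iff]
  exact hasProd_one_div_one_sub ((summable_nat_add_iff a).2 (summable_geometric_of_lt_one h0 h1))
    fun n => pow_lt_one₀ h0 h1 (show n + a ≠ 0 by omega)

theorem eulerInf_eq_mul_tprod (h0 : 0 ≤ x) (h1 : x < 1) :
    eulerInf x = (1 - x) * ∏' n : ℕ, (1 - x ^ (n + 2)) := by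
  rw [eulerInf, tprod_eq_zero_mul']
  · simp
  · exact multipliable_one_sub
      ((summable_nat_add_iff 2).2 (summable_geometric_of_lt_one h0 h1))

theorem tendsto_agProd_succ (h0 : 0 < x) (h1 : x < 1) :
    Tendsto (fun r => agProd r (r + 1) x) atTop (𝓝 (1 / eulerInf x)) := by
  simpa [chainResidue, chainAlpha, unitBaileyZero] using tendsto_agProd h0 h1 zero_le_one

/-- The surviving term `chainAlpha x 1 0 0 = 1 - x` cancels the first factor of Euler's product, so
the limit starts at `j = 2`. -/
theorem tendsto_agProd_one (h0 : 0 < x) (h1 : x < 1) :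
    Tendsto (fun r => agProd r 1 x) atTop (𝓝 (1 / ∏' n : ℕ, (1 - x ^ (n + 2)))) := by
  have h := tendsto_agProd h0 h1 le_rfl
  rw [eulerInf_eq_mul_tprod h0.le h1, show chainAlpha x 1 0 0 = (1 - x) * 1 by
    simp [chainAlpha, unitBaileyOne], mul_div_mul_left _ _ (sub_pos.2 h1).ne'] at h
  simpa [chainResidue] using h

variable (p : ℕ) [Fact p.Prime]

theorem AbPClass.eventually_exponent_le (c : AbPClass p) :
    ∀ᶠ r in atTop, c ∈ {c : AbPClass p | c.exponent ≤ p ^ r} := by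
  filter_upwards [eventually_ge_atTop c.exponent] with r hr
  exact hr.trans (Nat.lt_pow_self (Fact.out : p.Prime).one_lt).le

theorem hasSum_cardAut_le {r : ℕ} (hr : 1 ≤ r) :
    HasSum (fun c : {c : AbPClass p // c.exponent ≤ p ^ r} => 1 / (c.1.cardAut : ℝ))
      (agProd r (r + 1) (1 / p)) := by
  rw [← (dualClassEquiv p r).hasSum_iff]
  convert hasSum_agTerm (prime_one_div_pos p) (prime_one_div_lt_one p) zero_le_one hr using 1
  · exact funext fun k => (agTerm_eq_one_div_cardAut p k.2).symm
  · rfl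

theorem hasSum_cardHol_le {r : ℕ} (hr : 1 ≤ r) :
    HasSum (fun c : {c : AbPClass p // c.exponent ≤ p ^ r} => 1 / (c.1.cardHol : ℝ))
      (agProd r 1 (1 / p)) := by
  rw [← (dualClassEquiv p r).hasSum_iff]
  convert hasSum_agTerm (prime_one_div_pos p) (prime_one_div_lt_one p) le_rfl hr using 1
  · exact funext fun k => (agTerm_eq_one_div_cardHol p k.2).symm
  · rfl

theorem hasSum_card_le (r : ℕ) :
    HasSum (fun c : {c : AbPClass p // c.exponent ≤ p ^ r} => 1 / (c.1.card : ℝ))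
      (1 / eulerPoly r (1 / p)) := by
  rw [← (dualClassEquiv p r).hasSum_iff]
  convert hasSum_pow_sum_antitone (prime_one_div_pos p).le (prime_one_div_lt_one p) r using 1
  funext k
  rw [Function.comp_apply, dualClassEquiv_apply, card_dualClass p k.2, one_div_pow]
  push_cast
  rfl

theorem hasSum_cardAut :
    HasSum (fun c : AbPClass p => 1 / (c.cardAut : ℝ)) (1 / eulerInf (1 / p)) :=
  hasSum_of_exhaustion (fun c => by positivity) (AbPClass.eventually_exponent_le p)
    (by filter_upwards [eventually_ge_atTop 1] with r hr using hasSum_cardAut_le p hr)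
    (tendsto_agProd_succ (prime_one_div_pos p) (prime_one_div_lt_one p))

theorem hasSum_cardHol :
    HasSum (fun c : AbPClass p => 1 / (c.cardHol : ℝ))
      (1 / ∏' n : ℕ, (1 - (1 / p : ℝ) ^ (n + 2))) :=
  hasSum_of_exhaustion (fun c => by positivity) (AbPClass.eventually_exponent_le p)
    (by filter_upwards [eventually_ge_atTop 1] with r hr using hasSum_cardHol_le p hr)
    (tendsto_agProd_one (prime_one_div_pos p) (prime_one_div_lt_one p))

theorem hasSum_card : HasSum (fun c : AbPClass p => 1 / (c.card : ℝ)) (1 / eulerInf (1 / p)) :=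
  hasSum_of_exhaustion (fun c => by positivity) (AbPClass.eventually_exponent_le p)
    (Eventually.of_forall fun r => hasSum_card_le p r)
    (tendsto_const_nhds.div (tendsto_eulerPoly (prime_one_div_pos p).le (prime_one_div_lt_one p))
      (eulerInf_pos (prime_one_div_pos p).le (prime_one_div_lt_one p)).ne')

end Limits

theorem mainTheorem3 (p : ℕ) [Fact p.Prime] :
    -- fixed `r`
    (∀ r : ℕ, 1 ≤ r →
      -- the summation index of the Andrews-Gordon identity runs through the groups of
      -- exponent at most `p ^ r`, each isomorphism class once
      Set.BijOn (fun k : Fin r → ℕ => dualClass p k) {k | Antitone k}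
        {c | c.exponent ≤ p ^ r} ∧
      -- `i = r + 1`
      (∀ k : Fin r → ℕ, Antitone k →
        agTerm r (r + 1) (1 / p) k = 1 / ((dualClass p k).cardAut : ℝ)) ∧
      Multipliable (fun j : AGProdIndex r (r + 1) => geomFactor (1 / p) j) ∧
      HasSum (fun k : AGIndex r => agTerm r (r + 1) (1 / p) k) (agProd r (r + 1) (1 / p)) ∧
      HasSum (fun c : {c : AbPClass p // c.exponent ≤ p ^ r} => 1 / (c.1.cardAut : ℝ))
        (agProd r (r + 1) (1 / p)) ∧
      -- `i = 1`
      (∀ k : Fin r → ℕ, Antitone k →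
        agTerm r 1 (1 / p) k = 1 / ((dualClass p k).cardHol : ℝ)) ∧
      Multipliable (fun j : AGProdIndex r 1 => geomFactor (1 / p) j) ∧
      HasSum (fun k : AGIndex r => agTerm r 1 (1 / p) k) (agProd r 1 (1 / p)) ∧
      HasSum (fun c : {c : AbPClass p // c.exponent ≤ p ^ r} => 1 / (c.1.cardHol : ℝ))
        (agProd r 1 (1 / p))) ∧
    -- `r → ∞` with `i = r + 1`: both sides converge, and the limit is Hall's formula
    Summable (fun c : AbPClass p => 1 / (c.cardAut : ℝ)) ∧
    Summable (fun c : AbPClass p => 1 / (c.card : ℝ)) ∧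
    Tendsto (fun r : ℕ => ∑' k : AGIndex r, agTerm r (r + 1) (1 / p) k) atTop
      (𝓝 (∑' c : AbPClass p, 1 / (c.cardAut : ℝ))) ∧
    Tendsto (fun r : ℕ => agProd r (r + 1) (1 / p)) atTop
      (𝓝 (∑' c : AbPClass p, 1 / (c.card : ℝ))) ∧
    Multipliable (fun j : {j : ℕ // 1 ≤ j} => geomFactor (1 / p) j) ∧
    ∑' c : AbPClass p, 1 / (c.card : ℝ) = ∏' j : {j : ℕ // 1 ≤ j}, geomFactor (1 / p) j ∧
    HasSum (fun n : ℕ => (Fintype.card (Nat.Partition n) : ℝ) / (p : ℝ) ^ n)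
      (∑' c : AbPClass p, 1 / (c.card : ℝ)) ∧
    ∑' c : AbPClass p, 1 / (c.card : ℝ) = ∑' c : AbPClass p, 1 / (c.cardAut : ℝ) ∧
    -- `r → ∞` with `i = 1`
    Multipliable (fun j : {j : ℕ // 2 ≤ j} => geomFactor (1 / p) j) ∧
    Tendsto (fun r : ℕ => ∑' k : AGIndex r, agTerm r 1 (1 / p) k) atTop
      (𝓝 (∑' c : AbPClass p, 1 / (c.cardHol : ℝ))) ∧
    Tendsto (fun r : ℕ => agProd r 1 (1 / p)) atTop
      (𝓝 (∏' j : {j : ℕ // 2 ≤ j}, geomFactor (1 / p) j)) ∧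
    HasSum (fun c : AbPClass p => 1 / (c.cardHol : ℝ))
      (∏' j : {j : ℕ // 2 ≤ j}, geomFactor (1 / p) j) := by
  have h0 := prime_one_div_pos p
  have h1 := prime_one_div_lt_one p
  have prod1 := hasProd_geomFactor_ge h0.le h1 le_rfl
  have prod2 := hasProd_geomFactor_ge h0.le h1 one_le_two
  have ag0 : ∀ r, 1 ≤ r → HasSum (fun k : AGIndex r => agTerm r (r + 1) (1 / p) k)
      (agProd r (r + 1) (1 / p)) := fun r hr => hasSum_agTerm h0 h1 zero_le_one hr
  have ag1 : ∀ r, 1 ≤ r → HasSum (fun k : AGIndex r => agTerm r 1 (1 / p) k)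
      (agProd r 1 (1 / p)) := fun r hr => hasSum_agTerm h0 h1 le_rfl hr
  have lim0 := tendsto_agProd_succ h0 h1
  have lim1 := tendsto_agProd_one h0 h1
  have sumAut := hasSum_cardAut p
  have sumHol := hasSum_cardHol p
  have sumCard := hasSum_card p
  refine ⟨fun r hr => ⟨bijOn_dualClass p r, fun k hk => agTerm_eq_one_div_cardAut p hk,
      (hasProd_agProd h0.le h1 r (r + 1)).multipliable, ag0 r hr, hasSum_cardAut_le p hr,
      fun k hk => agTerm_eq_one_div_cardHol p hk, (hasProd_agProd h0.le h1 r 1).multipliable,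
      ag1 r hr, hasSum_cardHol_le p hr⟩, sumAut.summable, sumCard.summable, ?_, ?_,
    prod1.multipliable, ?_, ?_, ?_, prod2.multipliable, ?_, ?_, ?_⟩
  · rw [sumAut.tsum_eq]
    refine lim0.congr' ?_
    filter_upwards [eventually_ge_atTop 1] with r hr using (ag0 r hr).tsum_eq.symm
  · rwa [sumCard.tsum_eq]
  · rw [sumCard.tsum_eq, prod1.tprod_eq, eulerInf]
  · rw [sumCard.tsum_eq]
    convert hasSum_card_partition h0.le h1 using 1
    funext n
    rw [one_div_pow, mul_one_div]
  -- Hall's formula: both sums have been evaluated independently as `1 / eulerInf (1 / p)`.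
  · rw [sumCard.tsum_eq, sumAut.tsum_eq]
  · rw [sumHol.tsum_eq]
    refine lim1.congr' ?_
    filter_upwards [eventually_ge_atTop 1] with r hr using (ag1 r hr).tsum_eq.symm
  · rwa [prod2.tprod_eq]
  · rwa [prod2.tprod_eq]
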